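/- Let $\mathbb F$ be a field. A p-family over a commutative ring $R$ is a sequence $(f)=(f_n)_{n\in\mathbb N}$ of multivariate polynomials over $R$ whose numbers of variables and degrees are polynomially bounded in $n$. VP is the set of p-families over a field that are computed by algebraic circuits (with additions and multiplications of fan-in two, whose leaves are variables and field constants) with polynomially bounded number of nodes; VBP and VF are defined in the same way with skew circuits (each multiplication gate has a leaf among its inputs) and with formulas (circuits that are rooted trees), respectively. Let $\mathrm{HC}_n=\sum_\pi\prod_{i=1}^n x_{i,\pi(i)}$, where $\pi$ ranges over the cyclic permutations of $n$ symbols. Reductions. Write $f\le g$ if $f$ arises from $g$ by substituting variables and constants for the variables, and let $L^g(f)$ be the least number of nodes of a circuit with addition gates, multiplication gates and $g$-oracle gates that computes $f$. For p-families over a field $\mathbb F$, - $(f)\le_{\mathsf p}(g)$ (p-projection) if there is a polynomially bounded $t:\mathbb N\to\mathbb N$ with $f_n\le g_{t(n)}$ for all $n$; - $(f)\le_{\mathsf c}(g)$ (c-reduction) if there is a polynomially bounded $t$ such that $L^{g_{t(n)}}(f_n)$ is polynomially bounded; - $(f)\trianglelefteq_{\mathsf p}(g)$ (border p-projection) if there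 is a polynomially bounded $t$ such that for every $n$ there is a polynomial $h$ over $\mathbb F[\varepsilon]$ with $f_n+\varepsilon h\le g_{t(n)}$ over $\mathbb F(\varepsilon)$; - $(f)\trianglelefteq_{\mathsf c}(g)$ (border c-reduction) if there is a polynomially bounded $t$ such that the minimum over all polynomials $h$ over $\mathbb F[\varepsilon]$ of $L^{g_{t(n)}}(f_n+\varepsilon h)$, computed over $\mathbb F(\varepsilon)$, is polynomially bounded in $n$. VNP is the set of p-families $(f)$ with $(f)\le_{\mathsf p}(\mathrm{HC})$. For each of these four reductions $\le$, let $\mathrm{VNPC}(\le)$ be the set of $(f)\in\mathrm{VNP}$ with $(\mathrm{HC})\le(f)$, and for $\mathrm{C}\in\{\mathrm{VF},\mathrm{VBP},\mathrm{VP}\}$ let $\mathrm{CC}(\le)$ be the set of $(f)\in\mathrm C$ such that $(g)\le(f)$ for all $(g)\in\mathrm C$. All these classes are defined over every field. Density. For a class $A$ (defined over every field), the border closure $\overline A$ over $\mathbb F$ is the set of p-families $(f)$ over $\mathbb F$ for which there is a p-family $(g)$ over $\mathbb F[\varepsilon]$ such that $(f)+\varepsilon(g)$ lies in the class $A$ over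 the field $\mathbb F(\varepsilon)$. A class $A$ is a dense subset of a class $B$ over $\mathbb F$ if $A\subseteq B\subseteq\overline A$ over $\mathbb F$. Theorem. Over every field $\mathbb F$ the following hold. 1. For each $\le$ among $\le_{\mathsf p},\le_{\mathsf c},\trianglelefteq_{\mathsf p},\trianglelefteq_{\mathsf c}$: $\mathrm{VNPC}(\le)$ is a dense subset of $\mathrm{VNP}$, $\mathrm{VFC}(\le)$ is a dense subset of $\mathrm{VF}$, $\mathrm{VBPC}(\le)$ is a dense subset of $\mathrm{VBP}$, and $\mathrm{VPC}(\le)$ is a dense subset of $\mathrm{VP}$. 2. $\mathrm{VNP}\setminus\mathrm{VNPC}(\le_{\mathsf p})$ is a dense subset of $\mathrm{VNP}$, $\mathrm{VF}\setminus\mathrm{VFC}(\le_{\mathsf p})$ is a dense subset of $\mathrm{VF}$, $\mathrm{VBP}\setminus\mathrm{VBPC}(\le_{\mathsf p})$ is a dense subset of $\mathrm{VBP}$, and $\mathrm{VP}\setminus\mathrm{VPC}(\le_{\mathsf p})$ is a dense subset of $\mathrm{VP}$. -/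

import Mathlib

open MvPolynomial

universe u

namespace AlgComplexity

/-- A sequence of natural numbers is polynomially bounded. -/
def PolyBounded (t : ℕ → ℕ) : Prop :=
  ∃ p : Polynomial ℕ, ∀ n, t n ≤ p.eval n

/-- A sequence of multivariate polynomials over `R`, in variables taken from a countable supply. -/
abbrev Family (R : Type u) [CommRing R] : Type u := ℕ → MvPolynomial ℕ R

/-- A p-family: the number of occurring variables and the degree are polynomially bounded. -/
def IsPFamily {R : Type u} [CommRing R] (f : Family R) : Prop :=
  PolyBounded (fun n => (f n).vars.card) ∧ PolyBounded (fun n => (f n).totalDegree)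

/-! ### Circuits -/

/-- The label of a node of a circuit with node set `V` that may use, besides additions and
multiplications of fan-in two, oracle gates for the polynomials in `S`. The inputs of an oracle
gate for `g` are indexed by the variables of `g`. -/
inductive Gate {K : Type u} [Field K] (S : Set (MvPolynomial ℕ K)) (V : Type) : Type u
  | var (i : ℕ) : Gate S V
  | const (c : K) : Gate S V
  | add (a b : V) : Gate S V
  | mul (a b : V) : Gate S V
  | oracle (g : MvPolynomial ℕ K) (hg : g ∈ S) (args : g.vars → V) : Gate S V

namespace Gate

variable {K : Type u} [Field K] {S : Set (MvPolynomial ℕ K)} {V : Type}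

/-- The node `v` is a direct input of the gate. -/
def HasInput (v : V) : Gate S V → Prop
  | var _ => False
  | const _ => False
  | add a b => v = a ∨ v = b
  | mul a b => v = a ∨ v = b
  | oracle _ _ args => ∃ i, v = args i

/-- The gate is a leaf, that is, it is labelled with a variable or a constant. -/
def IsLeaf : Gate S V → Prop
  | var _ => True
  | const _ => True
  | _ => False

/-- The polynomial computed at a gate, given the polynomials `val` computed at all nodes. -/
noncomputable def value (val : V → MvPolynomial ℕ K) : Gate S V → MvPolynomial ℕ K
  | var i => X i
  | const c => C c
  | add a b => val a + val b
  | mul a b => val a * val b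
  | oracle g _ args => aeval (fun i : ℕ => if h : i ∈ g.vars then val (args ⟨i, h⟩) else 0) g

end Gate

/-- An algebraic circuit over `K` with oracle gates for the polynomials in `S`: a finite directed
acyclic graph with labelled nodes and a distinguished output node. -/
structure Circuit {K : Type u} [Field K] (S : Set (MvPolynomial ℕ K)) where
  Node : Type
  fintypeNode : Fintype Node
  gate : Node → Gate S Node
  acyclic : WellFounded (fun a b : Node => (gate b).HasInput a)
  root : Node

namespace Circuit

variable {K : Type u} [Field K] {S : Set (MvPolynomial ℕ K)}

/-- The size of a circuit is its number of nodes. -/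
def size (c : Circuit S) : ℕ := @Fintype.card c.Node c.fintypeNode

/-- The circuit computes `f` at its root. By acyclicity the polynomials `val v` computed at
the nodes are uniquely determined. -/
def Computes (c : Circuit S) (f : MvPolynomial ℕ K) : Prop :=
  ∃ val : c.Node → MvPolynomial ℕ K, (∀ v, val v = (c.gate v).value val) ∧ val c.root = f

/-- A circuit is skew if each multiplication gate has a leaf among its two inputs. -/
def IsSkew (c : Circuit S) : Prop :=
  ∀ v a b, c.gate v = Gate.mul a b → (c.gate a).IsLeaf ∨ (c.gate b).IsLeaf

end Circuit

/-- Formulas: circuits whose underlying graph is a rooted tree. -/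
inductive Formula (K : Type u) : Type u
  | var (i : ℕ) : Formula K
  | const (c : K) : Formula K
  | add (φ ψ : Formula K) : Formula K
  | mul (φ ψ : Formula K) : Formula K

namespace Formula

variable {K : Type u}

/-- The number of nodes. -/
def size : Formula K → ℕ
  | var _ => 1
  | const _ => 1
  | add φ ψ => φ.size + ψ.size + 1
  | mul φ ψ => φ.size + ψ.size + 1

/-- The polynomial computed by a formula. -/
noncomputable def eval [Field K] : Formula K → MvPolynomial ℕ K
  | var i => X i
  | const c => C c
  | add φ ψ => φ.eval + ψ.eval
  | mul φ ψ => φ.eval * ψ.eval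

end Formula

/-! ### Projections and oracle complexity -/

/-- `f ≤ g`: `f` arises from `g` by substituting variables and constants for the variables. -/
def IsProjection {K : Type u} [Field K] (f g : MvPolynomial ℕ K) : Prop :=
  ∃ α : ℕ → MvPolynomial ℕ K,
    (∀ i, (∃ j, α i = X j) ∨ (∃ c, α i = C c)) ∧ f = aeval α g

/-- `L^g(f) ≤ s`: some circuit of size at most `s` with `g`-oracle gates computes `f`. -/
def OracleComplexityLE {K : Type u} [Field K] (g f : MvPolynomial ℕ K) (s : ℕ) : Prop :=
  ∃ c : Circuit ({g} : Set (MvPolynomial ℕ K)), c.Computes f ∧ c.size ≤ s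

/-- A polynomial over `K`, viewed over `K(ε)`. -/
noncomputable def lift {K : Type u} [Field K] (f : MvPolynomial ℕ K) :
    MvPolynomial ℕ (RatFunc K) :=
  MvPolynomial.map (algebraMap K (RatFunc K)) f

/-- The polynomial `f + ε h` over `K(ε)`, for `f` over `K` and `h` over `K[ε]`. -/
noncomputable def perturb {K : Type u} [Field K] (f : MvPolynomial ℕ K)
    (h : MvPolynomial ℕ (Polynomial K)) : MvPolynomial ℕ (RatFunc K) :=
  lift f + C RatFunc.X * MvPolynomial.map (algebraMap (Polynomial K) (RatFunc K)) h

/-! ### The four reduction notions -/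

section Reductions

variable {K : Type u} [Field K]

/-- `(f) ≤_p (g)`. -/
def PProjection (f g : Family K) : Prop :=
  ∃ t : ℕ → ℕ, PolyBounded t ∧ ∀ n, IsProjection (f n) (g (t n))

/-- `(f) ≤_c (g)`. -/
def CReduction (f g : Family K) : Prop :=
  ∃ t : ℕ → ℕ, PolyBounded t ∧ ∃ s : ℕ → ℕ, PolyBounded s ∧
    ∀ n, OracleComplexityLE (g (t n)) (f n) (s n)

/-- `(f) ⊴_p (g)`. -/
def BorderPProjection (f g : Family K) : Prop :=
  ∃ t : ℕ → ℕ, PolyBounded t ∧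
    ∀ n, ∃ h : MvPolynomial ℕ (Polynomial K), IsProjection (perturb (f n) h) (lift (g (t n)))

/-- `(f) ⊴_c (g)`. -/
def BorderCReduction (f g : Family K) : Prop :=
  ∃ t : ℕ → ℕ, PolyBounded t ∧ ∃ s : ℕ → ℕ, PolyBounded s ∧
    ∀ n, ∃ h : MvPolynomial ℕ (Polynomial K),
      OracleComplexityLE (lift (g (t n))) (perturb (f n) h) (s n)

end Reductions

/-- The four kinds of reductions. -/
inductive ReductionKind
  | p
  | c
  | borderP
  | borderC

/-- `Reduces r f g`: the family `f` reduces to the family `g` under the reduction notion `r`. -/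
def Reduces {K : Type u} [Field K] : ReductionKind → Family K → Family K → Prop
  | .p => PProjection
  | .c => CReduction
  | .borderP => BorderPProjection
  | .borderC => BorderCReduction

/-! ### Complexity classes, for every field at once -/

/-- A complexity class assigns to every field a set of families over this field. -/
abbrev ComplexityClass : Type (u + 1) := ∀ (K : Type u) [Field K], Set (Family K)

/-- p-families with circuits of polynomially bounded size. -/
def VP : ComplexityClass.{u} := fun K _ =>
  {f | IsPFamily f ∧ ∃ s : ℕ → ℕ, PolyBounded s ∧
    ∀ n, ∃ c : Circuit (∅ : Set (MvPolynomial ℕ K)), c.Computes (f n) ∧ c.size ≤ s n}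

/-- p-families with skew circuits of polynomially bounded size. -/
def VBP : ComplexityClass.{u} := fun K _ =>
  {f | IsPFamily f ∧ ∃ s : ℕ → ℕ, PolyBounded s ∧
    ∀ n, ∃ c : Circuit (∅ : Set (MvPolynomial ℕ K)),
      c.IsSkew ∧ c.Computes (f n) ∧ c.size ≤ s n}

/-- p-families with formulas of polynomially bounded size. -/
def VF : ComplexityClass.{u} := fun K _ =>
  {f | IsPFamily f ∧ ∃ s : ℕ → ℕ, PolyBounded s ∧
    ∀ n, ∃ φ : Formula K, φ.eval = f n ∧ φ.size ≤ s n}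

open Classical in
/-- The Hamiltonian cycle family: the sum over all cyclic permutations `π` of `n` symbols of the
products `x_{1,π(1)} ⋯ x_{n,π(n)}`. The variable `x_{i,j}` has index `Nat.pair i j`. -/
noncomputable def HC (K : Type u) [Field K] : Family K := fun n =>
  ∑ π ∈ Finset.univ.filter (fun π : Equiv.Perm (Fin n) => π.IsCycleOn Set.univ),
    ∏ i : Fin n, X (Nat.pair i (π i))

/-- p-families that are p-projections of the Hamiltonian cycle family. -/
def VNP : ComplexityClass.{u} := fun K _ => {f | IsPFamily f ∧ PProjection f (HC K)}

/-- The families in VNP to which the Hamiltonian cycle family reduces under `r`. -/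
def VNPC (r : ReductionKind) : ComplexityClass.{u} := fun K _ =>
  {f | f ∈ VNP K ∧ Reduces r (HC K) f}

/-- The families in `A` to which every family in `A` reduces under `r`. -/
def Complete (A : ComplexityClass.{u}) (r : ReductionKind) : ComplexityClass.{u} := fun K _ =>
  {f | f ∈ A K ∧ ∀ g ∈ A K, Reduces r g f}

/-- The difference of two complexity classes, over every field. -/
def Diff (A B : ComplexityClass.{u}) : ComplexityClass.{u} := fun K _ => A K \ B K

/-- The border closure of `A` over `K`: the p-families `(f)` over `K` such that `(f) + ε (g)` lies
in `A` over `K(ε)` for some p-family `(g)` over `K[ε]`. -/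
def borderClosure (A : ComplexityClass.{u}) : ComplexityClass.{u} := fun K _ =>
  {f | IsPFamily f ∧ ∃ g : Family (Polynomial K), IsPFamily g ∧
    (fun n => perturb (f n) (g n)) ∈ A (RatFunc K)}

/-- Over `K`, the class `A` is a dense subset of the class `B`: it is contained in `B`, and every
element of `B` lies in the border closure of `A`. -/
def IsDenseIn (A B : ComplexityClass.{u}) (K : Type u) [Field K] : Prop :=
  A K ⊆ B K ∧ B K ⊆ borderClosure A K

end AlgComplexity

/-!
Let `U` be universal for a class `A`: every family in `A` is a projection of it, and `U` has
coefficients in the prime ring, so that this is still true over `K(ε)`. If `U'` is a copy of `U` in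
new variables, then `f + ε (y U' + z)` has `U` as a projection, by `y ↦ ε⁻¹` and a constant for `z`.
Hence it is complete under p-projections, and so under the three weaker reductions. Formulas have
universal polynomials given by `T ↦ T T + T`, with disjoint variables in the three copies of `T`,
because a formula is affine in a subformula that splits it into pieces of half the size. Skew
programs project from programs whose instructions are generic affine combinations of the preceding
values; for circuits, the instructions are split into homogeneous parts, which keeps the degree of
the generic program polynomially bounded.

The definition of VNP does not make its closure under sums evident, so `y U' + z` cannot just be
added there. But `f` is a Hamiltonian cycle sum with variables and constants as weights, and each
weight `p` can be replaced by `p + ε (y w + v)`. This frees the weights as above, and the new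
polynomial is again a projection of `HC`, because a product of three variables or constants can be
added to the weight of an edge by a detour through two new vertices.

For the incomplete families, replace each variable `x` by `x + ε x²`. Then not even a single
variable is a projection of the result.
-/

namespace AlgComplexity

/-! ### Polynomially bounded sequences and p-families -/

namespace PolyBounded

variable {s t : ℕ → ℕ}

theorem mono (ht : PolyBounded t) (hst : ∀ n, s n ≤ t n) : PolyBounded s := by
  obtain ⟨p, hp⟩ := ht
  exact ⟨p, fun n => (hst n).trans (hp n)⟩

theorem const (c : ℕ) : PolyBounded fun _ => c := ⟨Polynomial.C c, by simp⟩

theorem id : PolyBounded fun n => n := ⟨Polynomial.X, by simp⟩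

theorem add (hs : PolyBounded s) (ht : PolyBounded t) : PolyBounded fun n => s n + t n := by
  obtain ⟨p, hp⟩ := hs
  obtain ⟨q, hq⟩ := ht
  exact ⟨p + q, fun n => by simpa using add_le_add (hp n) (hq n)⟩

theorem mul (hs : PolyBounded s) (ht : PolyBounded t) : PolyBounded fun n => s n * t n := by
  obtain ⟨p, hp⟩ := hs
  obtain ⟨q, hq⟩ := ht
  exact ⟨p * q, fun n => by simpa using Nat.mul_le_mul (hp n) (hq n)⟩

theorem comp (hs : PolyBounded s) (ht : PolyBounded t) : PolyBounded fun n => s (t n) := by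
  obtain ⟨p, hp⟩ := hs
  obtain ⟨q, hq⟩ := ht
  refine ⟨p.comp q, fun n => (hp _).trans ?_⟩
  rw [Polynomial.eval_comp, Polynomial.eval_eq_sum, Polynomial.eval_eq_sum (x := q.eval n)]
  exact Finset.sum_le_sum fun i _ => Nat.mul_le_mul_left _ (Nat.pow_le_pow_left (hq n) i)

end PolyBounded

section VarsDegree

variable {σ τ R S : Type*} [CommSemiring R] [CommSemiring S]

theorem vars_card_add_le (p q : MvPolynomial σ R) :
    (p + q).vars.card ≤ p.vars.card + q.vars.card := by
  classical
  exact (Finset.card_le_card (vars_add_subset p q)).trans (Finset.card_union_le _ _)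

theorem vars_card_mul_le (p q : MvPolynomial σ R) :
    (p * q).vars.card ≤ p.vars.card + q.vars.card := by
  classical
  exact (Finset.card_le_card (vars_mul p q)).trans (Finset.card_union_le _ _)

theorem vars_card_X_le (i : σ) : (X i : MvPolynomial σ R).vars.card ≤ 1 := by
  cases subsingleton_or_nontrivial R
  · simp [Subsingleton.elim (X i : MvPolynomial σ R) 0]
  · simp

theorem totalDegree_X_le (i : σ) : (X i : MvPolynomial σ R).totalDegree ≤ 1 := by
  cases subsingleton_or_nontrivial R
  · simp [Subsingleton.elim (X i : MvPolynomial σ R) 0]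
  · simp

theorem totalDegree_map_le (φ : R →+* S) (p : MvPolynomial σ R) :
    (map φ p).totalDegree ≤ p.totalDegree :=
  Finset.sup_mono (support_map_subset φ p)

theorem vars_card_bind₁_le (g : σ → MvPolynomial τ R) {d : ℕ} (hg : ∀ i, (g i).vars.card ≤ d)
    (p : MvPolynomial σ R) : (bind₁ g p).vars.card ≤ p.vars.card * d := by
  classical
  exact (Finset.card_le_card (vars_bind₁ g p)).trans
    (Finset.card_biUnion_le_card_mul _ _ _ fun i _ => hg i)

theorem totalDegree_bind₁_le (g : σ → MvPolynomial τ R) {d : ℕ} (hg : ∀ i, (g i).totalDegree ≤ d)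
    (p : MvPolynomial σ R) : (bind₁ g p).totalDegree ≤ p.totalDegree * d := by
  conv_lhs => rw [p.as_sum, map_sum]
  refine totalDegree_finsetSum_le fun m hm => ?_
  calc (bind₁ g (monomial m (coeff m p))).totalDegree
      ≤ (∏ i ∈ m.support, g i ^ m i).totalDegree := by
        rw [bind₁_monomial]
        exact (totalDegree_mul _ _).trans (by rw [totalDegree_C, zero_add])
    _ ≤ ∑ i ∈ m.support, m i * d := (totalDegree_finsetProd _ _).trans
        (Finset.sum_le_sum fun i _ => (totalDegree_pow _ _).trans (Nat.mul_le_mul_left _ (hg i)))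
    _ ≤ p.totalDegree * d := by
        rw [← Finset.sum_mul]
        exact Nat.mul_le_mul_right _ (le_totalDegree hm)

theorem bind₁_X_comp (φ : σ → τ) (p : MvPolynomial σ R) :
    bind₁ (fun i => X (φ i)) p = rename φ p :=
  (bind₁_rename X φ p).symm.trans (DFunLike.congr_fun bind₁_X_left _)

theorem vars_subset_of_support_subset [DecidableEq σ] {p : MvPolynomial σ R}
    {q : MvPolynomial σ R} {r : MvPolynomial σ S} (h : p.support ⊆ q.support ∪ r.support) :
    p.vars ⊆ q.vars ∪ r.vars := by
  intro i hi
  obtain ⟨d, hd, hid⟩ := (mem_vars_iff_mem_support i).1 hi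
  simp only [Finset.mem_union, mem_vars_iff_mem_support]
  exact (Finset.mem_union.1 (h hd)).imp (⟨d, ·, hid⟩) (⟨d, ·, hid⟩)

end VarsDegree

namespace IsPFamily

variable {R S : Type*} [CommRing R] [CommRing S] {f g : Family R}

theorem add (hf : IsPFamily f) (hg : IsPFamily g) : IsPFamily fun n => f n + g n :=
  ⟨(hf.1.add hg.1).mono fun _ => vars_card_add_le _ _,
    (hf.2.add hg.2).mono fun _ => (totalDegree_add _ _).trans (max_le_add_of_nonneg
      (Nat.zero_le _) (Nat.zero_le _))⟩

theorem mul (hf : IsPFamily f) (hg : IsPFamily g) : IsPFamily fun n => f n * g n :=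
  ⟨(hf.1.add hg.1).mono fun _ => vars_card_mul_le _ _,
    (hf.2.add hg.2).mono fun _ => totalDegree_mul _ _⟩

theorem var (i : ℕ → ℕ) : IsPFamily fun n => (X (i n) : MvPolynomial ℕ R) :=
  ⟨(PolyBounded.const 1).mono fun _ => vars_card_X_le _,
    (PolyBounded.const 1).mono fun _ => totalDegree_X_le _⟩

theorem const (c : ℕ → R) : IsPFamily fun n => (C (c n) : MvPolynomial ℕ R) :=
  ⟨(PolyBounded.const 0).mono fun _ => by simp, (PolyBounded.const 0).mono fun _ => by simp⟩

theorem bind₁ (hf : IsPFamily f) (α : ℕ → ℕ → MvPolynomial ℕ R) {d : ℕ}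
    (hvars : ∀ n i, (α n i).vars.card ≤ d) (hdeg : ∀ n i, (α n i).totalDegree ≤ d) :
    IsPFamily fun n => MvPolynomial.bind₁ (α n) (f n) :=
  ⟨(hf.1.mul (.const d)).mono fun n => vars_card_bind₁_le _ (hvars n) _,
    (hf.2.mul (.const d)).mono fun n => totalDegree_bind₁_le _ (hdeg n) _⟩

theorem rename (hf : IsPFamily f) (φ : ℕ → ℕ → ℕ) :
    IsPFamily fun n => MvPolynomial.rename (φ n) (f n) := by
  simpa only [bind₁_X_comp] using hf.bind₁ (fun n i => X (φ n i))
    (fun _ _ => vars_card_X_le _) fun _ _ => totalDegree_X_le _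

theorem map (φ : R →+* S) (hf : IsPFamily f) : IsPFamily fun n => MvPolynomial.map φ (f n) := by
  classical
  exact ⟨hf.1.mono fun n => Finset.card_le_card (vars_map _ φ),
    hf.2.mono fun n => totalDegree_map_le φ _⟩

theorem of_support_subset {k : Family S} (hf : IsPFamily f) (hk : IsPFamily k)
    (h : ∀ n, (g n).support ⊆ (f n).support ∪ (k n).support) : IsPFamily g := by
  classical
  refine ⟨(hf.1.add hk.1).mono fun n => ?_, (hf.2.add hk.2).mono fun n => ?_⟩
  · exact (Finset.card_le_card (vars_subset_of_support_subset (h n))).trans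
      (Finset.card_union_le _ _)
  · refine Finset.sup_le fun d hd => ?_
    rcases Finset.mem_union.1 (h n hd) with hd | hd
    · exact (le_totalDegree hd).trans (Nat.le_add_right _ _)
    · exact (le_totalDegree hd).trans (Nat.le_add_left _ _)

end IsPFamily

/-! ### Perturbations -/

section Perturbation

variable {K : Type u} [Field K]

/-- Polynomials over `K[ε]`, viewed over `K(ε)`. -/
noncomputable abbrev toRat : MvPolynomial ℕ (Polynomial K) →+* MvPolynomial ℕ (RatFunc K) :=
  map (algebraMap (Polynomial K) (RatFunc K))

/-- `F` over `K(ε)` is of the form `f + ε h` with `h` over `K[ε]`: it degenerates to `f` as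
`ε → 0`. -/
def IsPerturbation (F : MvPolynomial ℕ (RatFunc K)) (f : MvPolynomial ℕ K) : Prop :=
  ∃ h : MvPolynomial ℕ (Polynomial K), F = perturb f h

theorem toRat_map_C (f : MvPolynomial ℕ K) : toRat (map Polynomial.C f) = lift f := by
  rw [toRat, lift, map_map]
  rfl

theorem isPerturbation_iff {F : MvPolynomial ℕ (RatFunc K)} {f : MvPolynomial ℕ K} :
    IsPerturbation F f ↔
      ∃ G : MvPolynomial ℕ (Polynomial K), toRat G = F ∧ map Polynomial.constantCoeff G = f := by
  constructor
  · rintro ⟨h, rfl⟩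
    refine ⟨map Polynomial.C f + C Polynomial.X * h, ?_, ?_⟩
    · rw [map_add, map_mul, toRat_map_C, map_C, RatFunc.algebraMap_X, perturb]
    · ext
      simp [coeff_map]
  · rintro ⟨G, rfl, hG⟩
    have hdvd : (C Polynomial.X : MvPolynomial ℕ (Polynomial K)) ∣ G - map Polynomial.C f := by
      rw [C_dvd_iff_dvd_coeff]
      intro m
      rw [Polynomial.X_dvd_iff, coeff_sub, coeff_map, Polynomial.coeff_sub, ← hG, coeff_map]
      simp
    obtain ⟨h, hh⟩ := hdvd
    refine ⟨h, ?_⟩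
    rw [sub_eq_iff_eq_add'.1 hh, map_add, map_mul, toRat_map_C, map_C, RatFunc.algebraMap_X,
      perturb]

theorem IsPFamily.of_perturb {f : Family K} {g : Family (Polynomial K)} (hf : IsPFamily f)
    (h : IsPFamily fun n => perturb (f n) (g n)) : IsPFamily g := by
  classical
  refine IsPFamily.of_support_subset (hf.map Polynomial.C) h fun n d hd => ?_
  by_contra hmem
  simp only [Finset.mem_union, mem_support_iff, not_or, not_not] at hmem
  obtain ⟨hf0, hF0⟩ := hmem
  rw [coeff_map, map_eq_zero_iff _ Polynomial.C_injective] at hf0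
  rw [perturb, coeff_add, lift, coeff_map, hf0, map_zero, zero_add, coeff_C_mul, coeff_map,
    mul_eq_zero, map_eq_zero_iff _ (RatFunc.algebraMap_injective K)] at hF0
  exact mem_support_iff.1 hd (hF0.resolve_left RatFunc.X_ne_zero)

/-- Only the perturbed families have to be shown to lie in `A`: that the perturbation terms form
a p-family is automatic. -/
theorem isDenseIn_of_isPerturbation {A B : ComplexityClass.{u}} (hAB : A K ⊆ B K)
    (hA : ∀ F ∈ A (RatFunc K), IsPFamily F) (hB : ∀ f ∈ B K, IsPFamily f)
    (h : ∀ f ∈ B K, ∃ F ∈ A (RatFunc K), ∀ n, IsPerturbation (F n) (f n)) :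
    IsDenseIn A B K := by
  refine ⟨hAB, fun f hf => ⟨hB f hf, ?_⟩⟩
  obtain ⟨F, hF, hFf⟩ := h f hf
  choose g hg using hFf
  obtain rfl : F = fun n => perturb (f n) (g n) := funext hg
  exact ⟨g, (hB f hf).of_perturb (hA _ hF), hF⟩

end Perturbation

/-! ### Projections -/

section Projection

variable {σ τ R S : Type*} [CommSemiring R] [CommSemiring S]

/-- Variables and constants, the admissible values of a projection. -/
def IsVarOrConst (p : MvPolynomial σ R) : Prop := (∃ j, p = X j) ∨ ∃ c, p = C c

namespace IsVarOrConst

variable {p : MvPolynomial σ R}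

theorem X (j : σ) : IsVarOrConst (X j : MvPolynomial σ R) := .inl ⟨j, rfl⟩

theorem C (c : R) : IsVarOrConst (C c : MvPolynomial σ R) := .inr ⟨c, rfl⟩

theorem zero : IsVarOrConst (0 : MvPolynomial σ R) := .inr ⟨0, C_0.symm⟩

theorem one : IsVarOrConst (1 : MvPolynomial σ R) := .inr ⟨1, C_1.symm⟩

theorem bind₁ (hp : IsVarOrConst p) {α : σ → MvPolynomial τ R} (hα : ∀ i, IsVarOrConst (α i)) :
    IsVarOrConst (bind₁ α p) := by
  rcases hp with ⟨j, rfl⟩ | ⟨c, rfl⟩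
  · rw [bind₁_X_right]
    exact hα j
  · rw [bind₁_C_right]
    exact .C c

theorem map (φ : R →+* S) (hp : IsVarOrConst p) : IsVarOrConst (map φ p) := by
  rcases hp with ⟨j, rfl⟩ | ⟨c, rfl⟩
  · rw [map_X]
    exact .X j
  · rw [map_C]
    exact .C _

theorem vars_card_le (hp : IsVarOrConst p) : p.vars.card ≤ 1 := by
  rcases hp with ⟨j, rfl⟩ | ⟨c, rfl⟩
  · exact vars_card_X_le j
  · simp

theorem totalDegree_le (hp : IsVarOrConst p) : p.totalDegree ≤ 1 := by
  rcases hp with ⟨j, rfl⟩ | ⟨c, rfl⟩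
  · exact totalDegree_X_le j
  · simp

end IsVarOrConst

variable {K : Type u} [Field K] {f g h : MvPolynomial ℕ K}

theorem isProjection_iff : IsProjection f g ↔
    ∃ α : ℕ → MvPolynomial ℕ K, (∀ i, IsVarOrConst (α i)) ∧ f = bind₁ α g :=
  Iff.rfl

theorem IsProjection.trans (hfg : IsProjection f g) (hgh : IsProjection g h) :
    IsProjection f h := by
  rw [isProjection_iff] at *
  obtain ⟨α, hα, rfl⟩ := hfg
  obtain ⟨β, hβ, rfl⟩ := hgh
  exact ⟨fun i => bind₁ α (β i), fun i => (hβ i).bind₁ hα, bind₁_bind₁ _ _ _⟩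

theorem PProjection.trans {f g h : Family K} (hfg : PProjection f g) (hgh : PProjection g h) :
    PProjection f h := by
  obtain ⟨t, ht, hfg⟩ := hfg
  obtain ⟨s, hs, hgh⟩ := hgh
  exact ⟨fun n => s (t n), hs.comp ht, fun n => (hfg n).trans (hgh _)⟩

theorem IsProjection.lift (hfg : IsProjection f g) : IsProjection (lift f) (lift g) := by
  rw [isProjection_iff] at *
  obtain ⟨α, hα, rfl⟩ := hfg
  exact ⟨fun i => AlgComplexity.lift (α i), fun i => (hα i).map _, map_bind₁ _ _ _⟩

theorem IsVarOrConst.exists_gate (S : Set (MvPolynomial ℕ K)) (V : Type)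
    (hf : IsVarOrConst f) :
    ∃ γ : Gate S V, γ.IsLeaf ∧ (∀ v, ¬ γ.HasInput v) ∧ ∀ val, γ.value val = f := by
  rcases hf with ⟨j, rfl⟩ | ⟨c, rfl⟩
  · exact ⟨.var j, trivial, fun _ => id, fun _ => rfl⟩
  · exact ⟨.const c, trivial, fun _ => id, fun _ => rfl⟩

theorem IsProjection.oracleComplexityLE (hfg : IsProjection f g) :
    OracleComplexityLE g f (g.vars.card + 1) := by
  classical
  obtain ⟨α, hα, rfl⟩ := isProjection_iff.1 hfg
  choose γ hγ using fun i => (hα i).exists_gate {g} (Option g.vars)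
  let gate : Option g.vars → Gate {g} (Option g.vars)
    | some i => γ i
    | none => .oracle g rfl some
  have hacc_leaf (i : g.vars) : Acc (fun a b => (gate b).HasInput a) (some i) :=
    ⟨_, fun v hv => absurd hv ((hγ i).2.1 v)⟩
  have hacc (o : Option g.vars) : Acc (fun a b => (gate b).HasInput a) o := by
    cases o with
    | some i => exact hacc_leaf i
    | none => exact ⟨_, fun _ ⟨i, hi⟩ => hi ▸ hacc_leaf i⟩
  refine ⟨⟨_, inferInstance, gate, ⟨hacc⟩, none⟩,
    ⟨fun o => o.elim (bind₁ α g) (fun i => α i), ?_, rfl⟩, by simp [Circuit.size]⟩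
  rintro (_ | i)
  · refine eval₂Hom_congr' rfl (fun i hi _ => ?_) rfl
    simp [hi]
  · exact ((hγ i).2.2 _).symm

theorem perturb_zero (f : MvPolynomial ℕ K) : perturb f 0 = lift f := by
  simp [perturb]

theorem PProjection.reduces {f g : Family K} (hfg : PProjection f g) (hg : IsPFamily g)
    (r : ReductionKind) : Reduces r f g := by
  obtain ⟨t, ht, hproj⟩ := hfg
  have hs : PolyBounded fun n => (g (t n)).vars.card + 1 := (hg.1.comp ht).add (.const 1)
  cases r with
  | p => exact ⟨t, ht, hproj⟩
  | c => exact ⟨t, ht, _, hs, fun n => (hproj n).oracleComplexityLE⟩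
  | borderP => exact ⟨t, ht, fun n => ⟨0, perturb_zero (f n) ▸ (hproj n).lift⟩⟩
  | borderC =>
    refine ⟨t, ht, _, hs, fun n => ⟨0, ?_⟩⟩
    rw [perturb_zero]
    obtain ⟨c, hc, hle⟩ := (hproj n).lift.oracleComplexityLE
    exact ⟨c, hc, hle.trans (Nat.succ_le_succ (Finset.card_le_card (vars_map _ _)))⟩

end Projection

/-! ### Quadratic deformations -/

section Deformation

variable {R S : Type*} [CommRing R] [CommRing S]

/-- The substitution `xᵢ ↦ xᵢ + e xᵢ²`. For `e = ε` it perturbs every polynomial into one that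
does not even have a variable as a projection. -/
noncomputable def deform (e : R) : MvPolynomial ℕ R →ₐ[R] MvPolynomial ℕ R :=
  bind₁ fun i => X i + C e * (X i * X i)

theorem deform_X (e : R) (i : ℕ) : deform e (X i) = X i + C e * (X i * X i) :=
  bind₁_X_right _ i

theorem deform_C (e c : R) : deform e (C c) = C c := bind₁_C_right _ c

theorem deform_zero (f : MvPolynomial ℕ R) : deform 0 f = f := by
  simp [deform, bind₁_X_left]

theorem map_deform (φ : R →+* S) (e : R) (f : MvPolynomial ℕ R) :
    map φ (deform e f) = deform (φ e) (map φ f) := by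
  simp [deform, map_bind₁]

theorem IsPFamily.deform (e : R) {f : Family R} (hf : IsPFamily f) :
    IsPFamily fun n => deform e (f n) := by
  refine hf.bind₁ (d := 3) _ (fun _ i => ?_) fun _ i => ?_
  · have h := vars_card_X_le (R := R) i
    have hmul := vars_card_mul_le (X i : MvPolynomial ℕ R) (X i)
    have hC := vars_card_mul_le (C e) (X i * X i)
    have hadd := vars_card_add_le (X i) (C e * (X i * X i))
    rw [vars_C, Finset.card_empty] at hC
    lia
  · have h := totalDegree_X_le (R := R) i
    have hmul := totalDegree_mul (X i : MvPolynomial ℕ R) (X i)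
    have hC := totalDegree_mul (C e) (X i * X i)
    have hadd := totalDegree_add (X i) (C e * (X i * X i))
    rw [totalDegree_C] at hC
    lia

variable {K : Type u} [Field K]

theorem isPerturbation_deform (f : MvPolynomial ℕ K) :
    IsPerturbation (deform RatFunc.X (lift f)) f := by
  refine isPerturbation_iff.2 ⟨deform Polynomial.X (map Polynomial.C f), ?_, ?_⟩
  · rw [map_deform, toRat_map_C, RatFunc.algebraMap_X]
  · rw [map_deform, Polynomial.constantCoeff_apply, Polynomial.coeff_X_zero, deform_zero, map_map]
    exact (congrArg (map · f) (by ext; simp)).trans (map_id f)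

/-- Identify all variables with one variable `t`: what remains of the deformed polynomial is a
polynomial in `t + e t²`, which cannot be `t`. -/
theorem not_isProjection_X_deform {e : K} (he : e ≠ 0) (j : ℕ) (f : MvPolynomial ℕ K) :
    ¬ IsProjection (X j) (deform e f) := by
  rw [isProjection_iff]
  rintro ⟨α, hα, h⟩
  set Q : Polynomial K := Polynomial.X + Polynomial.C e * (Polynomial.X * Polynomial.X) with hQ
  have hβ (i : ℕ) : ∃ b : Polynomial K,
      aeval (fun _ : ℕ => Polynomial.X) (α i + C e * (α i * α i)) = Polynomial.aeval Q b := by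
    rcases hα i with ⟨k, hk⟩ | ⟨c, hc⟩
    · exact ⟨Polynomial.X, by simp [hk, hQ, Polynomial.algebraMap_eq]⟩
    · exact ⟨Polynomial.C (c + e * (c * c)), by simp [hc, Polynomial.algebraMap_eq]⟩
  choose b hb using hβ
  have hcomp : (Polynomial.X : Polynomial K) = (aeval b f).comp Q := by
    calc Polynomial.X = aeval (fun _ : ℕ => Polynomial.X) (X j : MvPolynomial ℕ K) := by simp
      _ = aeval (fun i => Polynomial.aeval Q (b i)) f := by
        rw [h, deform, bind₁_bind₁, aeval_bind₁]
        simp only [map_add, map_mul, bind₁_X_right, bind₁_C_right, ← hb]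
      _ = (aeval b f).comp Q := (comp_aeval_apply _ _ _).symm
  have hdeg : Q.natDegree = 2 := by rw [hQ]; compute_degree!
  have := congrArg Polynomial.natDegree hcomp
  rw [Polynomial.natDegree_X, Polynomial.natDegree_comp, hdeg] at this
  lia

end Deformation

/-! ### Density of the incomplete families -/

section DiffDensity

variable {K : Type u} [Field K]

theorem isDenseIn_diff {A B : ComplexityClass.{u}}
    (hA : ∀ (L : Type u) [Field L], ∀ f ∈ A L, IsPFamily f)
    (hdeform : ∀ f ∈ A K, (fun n => deform RatFunc.X (lift (f n))) ∈ A (RatFunc K))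
    (hB : ∀ F ∈ B (RatFunc K), ∃ n, IsProjection (X 0) (F n)) :
    IsDenseIn (Diff A B) A K := by
  refine isDenseIn_of_isPerturbation (fun _ hf => hf.1) (fun F hF => hA _ F hF.1) (hA K)
    fun f hf => ⟨_, ⟨hdeform f hf, fun hFB => ?_⟩, fun n => isPerturbation_deform (f n)⟩
  obtain ⟨n, hn⟩ := hB _ hFB
  exact not_isProjection_X_deform RatFunc.X_ne_zero 0 _ hn

end DiffDensity

/-! ### Classes defined by complexity measures -/

/-- Closure properties of a complexity measure, given as the relation "`p` has complexity at most
`n`" over all fields, which suffice to perturb the polynomials of low complexity. -/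
structure IsMeasure (Cx : ∀ (K : Type u) [Field K], MvPolynomial ℕ K → ℕ → Prop) : Prop where
  mono : ∀ {K : Type u} [Field K] {p : MvPolynomial ℕ K} {a b : ℕ}, Cx K p a → a ≤ b → Cx K p b
  varOrConst : ∀ {K : Type u} [Field K] {p : MvPolynomial ℕ K}, IsVarOrConst p → Cx K p 1
  add : ∀ {K : Type u} [Field K] {p q : MvPolynomial ℕ K} {a b : ℕ},
    Cx K p a → Cx K q b → Cx K (p + q) (a + b + 1)
  mul : ∀ {K : Type u} [Field K] {p q : MvPolynomial ℕ K} {a : ℕ},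
    IsVarOrConst q → Cx K p a → Cx K (q * p) (a + 2)
  rename : ∀ {K : Type u} [Field K] {p : MvPolynomial ℕ K} {a : ℕ} (φ : ℕ → ℕ),
    Cx K p a → Cx K (MvPolynomial.rename φ p) a
  map : ∀ {K L : Type u} [Field K] [Field L] {p : MvPolynomial ℕ K} {a : ℕ} (φ : K →+* L),
    Cx K p a → Cx L (MvPolynomial.map φ p) a
  deform : ∀ {K : Type u} [Field K] {p : MvPolynomial ℕ K} {a : ℕ} (e : K),
    Cx K p a → Cx K (deform e p) (7 * a)

/-- The p-families of polynomially bounded complexity. -/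
def classOf (Cx : ∀ (K : Type u) [Field K], MvPolynomial ℕ K → ℕ → Prop) :
    ComplexityClass.{u} := fun K _ =>
  {f | IsPFamily f ∧ ∃ s : ℕ → ℕ, PolyBounded s ∧ ∀ n, Cx K (f n) (s n)}

/-- A variable index above all variables of `f`. -/
noncomputable def freshVar {R : Type*} [CommSemiring R] (f : MvPolynomial ℕ R) : ℕ :=
  f.vars.sup id + 1

theorem lt_freshVar {R : Type*} [CommSemiring R] {f : MvPolynomial ℕ R} {i : ℕ}
    (hi : i ∈ f.vars) : i < freshVar f :=
  Nat.lt_succ_of_le (Finset.le_sup (f := id) hi)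

theorem bind₁_eq_C_constantCoeff {σ τ R : Type*} [CommSemiring R] {α : σ → MvPolynomial τ R}
    {p : MvPolynomial σ R} (h : ∀ i ∈ p.vars, α i = 0) : bind₁ α p = C (constantCoeff p) :=
  (eval₂Hom_congr' rfl (fun i hi _ => h i hi) rfl).trans (aeval_zero' p)

section AttachCopy

variable {K : Type u} [Field K] {f U : MvPolynomial ℕ K}

/-- The perturbation `f + ε (x_M U' + x_{M+1})`, where `U'` is a copy of `U` in new variables and
`M` is the first fresh index. It has `U` as a projection: `x_M ↦ ε⁻¹` undoes the factor `ε`, and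
`x_{M+1}` cancels the constant that remains of `f` when its variables are set to zero. -/
noncomputable def attachCopy (f U : MvPolynomial ℕ K) : MvPolynomial ℕ (RatFunc K) :=
  perturb f (X (freshVar f) * rename (freshVar f + 2 + ·) (map Polynomial.C U) +
    X (freshVar f + 1))

theorem attachCopy_eq : attachCopy f U = lift f + C RatFunc.X *
    (X (freshVar f) * rename (freshVar f + 2 + ·) (lift U) + X (freshVar f + 1)) := by
  simp only [attachCopy, perturb, map_add, map_mul, map_X, map_rename, toRat_map_C]

theorem isProjection_lift_attachCopy : IsProjection (lift U) (attachCopy f U) := by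
  set M := freshVar f with hM
  set a : RatFunc K := constantCoeff (lift f)
  let α : ℕ → MvPolynomial ℕ (RatFunc K) := fun i =>
    if i < M then 0 else if i = M then C RatFunc.X⁻¹ else
      if i = M + 1 then C (-(RatFunc.X⁻¹ * a)) else X (i - (M + 2))
  refine isProjection_iff.2 ⟨α, fun i => ?_, ?_⟩
  · simp only [α]
    split_ifs
    exacts [.zero, .C _, .C _, .X _]
  have hf : bind₁ α (lift f) = C a :=
    bind₁_eq_C_constantCoeff fun i hi => if_pos (lt_freshVar (vars_map _ _ hi))
  have hU : bind₁ α (rename (M + 2 + ·) (lift U)) = lift U := by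
    have hα : α ∘ (M + 2 + ·) = X := by
      funext i
      simp [α, show ¬ M + 2 + i < M by lia, show M + 2 + i ≠ M by lia,
        show M + 2 + i ≠ M + 1 by lia]
    rw [bind₁_rename, hα, bind₁_X_left, AlgHom.id_apply]
  have hαM : α M = C RatFunc.X⁻¹ := by simp [α]
  have hαM' : α (M + 1) = -(C RatFunc.X⁻¹ * C a) := by simp [α]
  have hinv : (C RatFunc.X * C RatFunc.X⁻¹ : MvPolynomial ℕ (RatFunc K)) = 1 := by
    rw [← C_mul, mul_inv_cancel₀ RatFunc.X_ne_zero, C_1]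
  rw [attachCopy_eq, map_add, map_mul, map_add, map_mul, ← hM, hf, hU, bind₁_X_right,
    bind₁_X_right, bind₁_C_right, hαM, hαM']
  linear_combination (C a - lift U) * hinv

end AttachCopy

section MeasureDensity

variable {Cx : ∀ (K : Type u) [Field K], MvPolynomial ℕ K → ℕ → Prop} {K : Type u} [Field K]

theorem IsMeasure.attachCopy (h : IsMeasure Cx) {f U : MvPolynomial ℕ K} {a b : ℕ}
    (hf : Cx K f a) (hU : Cx K U b) : Cx (RatFunc K) (attachCopy f U) (a + b + 7) := by
  rw [attachCopy_eq]
  refine h.mono (h.add (h.map _ hf) (h.mul (.C _) (h.add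
    (h.mul (.X _) (h.rename _ (h.map _ hU))) (h.varOrConst (.X _))))) ?_
  lia

theorem IsMeasure.attachCopy_mem (h : IsMeasure Cx) {f U : Family K} (hf : f ∈ classOf Cx K)
    (hU : U ∈ classOf Cx K) : (fun n => AlgComplexity.attachCopy (f n) (U n)) ∈
      classOf Cx (RatFunc K) := by
  obtain ⟨hpf, s, hs, hsf⟩ := hf
  obtain ⟨hpU, t, ht, htU⟩ := hU
  refine ⟨?_, _, (hs.add ht).add (.const 7), fun n => h.attachCopy (hsf n) (htU n)⟩
  simp only [attachCopy_eq]
  exact (hpf.map _).add ((IsPFamily.const _).mul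
    (((IsPFamily.var _).mul ((hpU.map _).rename _)).add (.var _)))

theorem isDenseIn_complete (h : IsMeasure Cx) {U : Family K} (hU : U ∈ classOf Cx K)
    (huniv : ∀ G ∈ classOf Cx (RatFunc K), PProjection G fun n => lift (U n))
    (r : ReductionKind) : IsDenseIn (Complete (classOf Cx) r) (classOf Cx) K := by
  refine isDenseIn_of_isPerturbation (fun _ hf => hf.1) (fun _ hF => hF.1.1) (fun _ hf => hf.1)
    fun f hf => ⟨fun n => attachCopy (f n) (U n), ⟨h.attachCopy_mem hf hU, fun G hG => ?_⟩,
      fun n => ⟨_, rfl⟩⟩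
  have hUF : PProjection (fun n => lift (U n)) fun n => attachCopy (f n) (U n) :=
    ⟨fun n => n, .id, fun n => isProjection_lift_attachCopy⟩
  exact ((huniv G hG).trans hUF).reduces (h.attachCopy_mem hf hU).1 r

theorem isDenseIn_diff_complete (h : IsMeasure Cx) :
    IsDenseIn (Diff (classOf Cx) (Complete (classOf Cx) .p)) (classOf Cx) K := by
  refine isDenseIn_diff (fun _ _ _ hf => hf.1) ?_ ?_
  · rintro f ⟨hpf, s, hs, hsf⟩
    exact ⟨(hpf.map _).deform _, _, (PolyBounded.const 7).mul hs,
      fun n => h.deform _ (h.map _ (hsf n))⟩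
  · rintro F ⟨-, hcomp⟩
    obtain ⟨t, -, ht⟩ :=
      hcomp (fun _ => X 0) ⟨.var _, _, .const 1, fun _ => h.varOrConst (.X 0)⟩
    exact ⟨t 0, ht 0⟩

end MeasureDensity

/-! ### Formulas -/

/-- Some formula of size at most `n` evaluates to `p`. -/
def FormulaLE (K : Type u) [Field K] (p : MvPolynomial ℕ K) (n : ℕ) : Prop :=
  ∃ φ : Formula K, φ.eval = p ∧ φ.size ≤ n

namespace Formula

variable {K L : Type u}

/-- Substitution of the formulas `s i` for the variables, with `φ` applied to the constants. -/
def subst (φ : K → L) (s : ℕ → Formula L) : Formula K → Formula L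
  | var i => s i
  | const c => const (φ c)
  | add a b => add (a.subst φ s) (b.subst φ s)
  | mul a b => mul (a.subst φ s) (b.subst φ s)

theorem size_pos (a : Formula K) : 0 < a.size := by
  cases a <;> simp only [size] <;> lia

theorem size_subst_le (φ : K → L) {s : ℕ → Formula L} {k : ℕ} (hs : ∀ i, (s i).size ≤ k)
    (a : Formula K) : (a.subst φ s).size ≤ k * a.size := by
  have hk : 0 < k := (s 0).size_pos.trans_le (hs 0)
  induction a with
  | var i => simpa [subst, size] using hs i
  | const c => simpa only [subst, size, mul_one] using Nat.succ_le_of_lt hk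
  | add a b ha hb | mul a b ha hb =>
    simp only [subst, size, mul_add]
    lia

theorem eval_subst [Field K] [Field L] (φ : K →+* L) (s : ℕ → Formula L) (a : Formula K) :
    (a.subst φ s).eval = bind₁ (fun i => (s i).eval) (MvPolynomial.map φ a.eval) := by
  induction a <;> simp_all [subst, eval]

/-- The number of operations. -/
def gates : Formula K → ℕ
  | var _ => 0
  | const _ => 0
  | add a b => a.gates + b.gates + 1
  | mul a b => a.gates + b.gates + 1

theorem gates_lt_size (a : Formula K) : a.gates < a.size := by
  induction a <;> simp only [gates, size] <;> lia

variable [Field K]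

theorem vars_card_eval_le (a : Formula K) : a.eval.vars.card ≤ a.size := by
  induction a with
  | var i => exact vars_card_X_le i
  | const c => simp [eval]
  | add a b ha hb => exact (vars_card_add_le _ _).trans (by simp only [size]; lia)
  | mul a b ha hb => exact (vars_card_mul_le _ _).trans (by simp only [size]; lia)

theorem totalDegree_eval_le (a : Formula K) : a.eval.totalDegree ≤ a.size := by
  induction a with
  | var i => exact totalDegree_X_le i
  | const c => simp [eval]
  | add a b ha hb => exact (totalDegree_add _ _).trans (by simp only [size]; lia)
  | mul a b ha hb => exact (totalDegree_mul _ _).trans (by simp only [size]; lia)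

/-- Some subformula `ψ₁ + ψ₂` or `ψ₁ ψ₂` of `φ` separates it into pieces that have at least `N`
gates less: `ψ₁`, `ψ₂` and the formulas `A₀`, `A₁` that arise from `φ` by replacing the
subformula with `0` and `1`. As `φ` is affine in its subformulas, these pieces determine it. -/
def HasSeparator (N : ℕ) (φ : Formula K) : Prop :=
  ∃ ψ₁ ψ₂ A₀ A₁ : Formula K, ∃ q : MvPolynomial ℕ K,
    (q = ψ₁.eval + ψ₂.eval ∨ q = ψ₁.eval * ψ₂.eval) ∧ ψ₁.gates ≤ N ∧ ψ₂.gates ≤ N ∧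
    A₀.gates + N < φ.gates ∧ A₁.gates + N < φ.gates ∧
    φ.eval = (A₁.eval - A₀.eval) * q + A₀.eval

theorem HasSeparator.context {N k : ℕ} {φ : Formula K} (hφ : φ.HasSeparator N)
    (c : Formula K → Formula K) (u w : MvPolynomial ℕ K)
    (hgates : ∀ A, (c A).gates = A.gates + k) (heval : ∀ A, (c A).eval = u * A.eval + w) :
    (c φ).HasSeparator N := by
  obtain ⟨ψ₁, ψ₂, A₀, A₁, q, hq, hψ₁, hψ₂, hA₀, hA₁, hφ⟩ := hφ
  refine ⟨ψ₁, ψ₂, c A₀, c A₁, q, hq, hψ₁, hψ₂, ?_, ?_, ?_⟩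
  · simp only [hgates]
    lia
  · simp only [hgates]
    lia
  · simp only [heval, hφ]
    ring

/-- Descend from the root into an operand with more than `N` gates as long as there is one. -/
theorem hasSeparator {N : ℕ} {φ : Formula K} (h : N < φ.gates) : φ.HasSeparator N := by
  induction φ with
  | var i | const c => exact absurd h (Nat.not_lt_zero N)
  | add a b iha ihb =>
    by_cases ha : N < a.gates
    · exact (iha ha).context (k := b.gates + 1) (add · b) 1 b.eval
        (fun A => by simp only [gates]; lia) fun A => by simp only [eval]; ring
    by_cases hb : N < b.gates
    · exact (ihb hb).context (k := a.gates + 1) (add a ·) 1 a.eval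
        (fun A => by simp only [gates]; lia) fun A => by simp only [eval]; ring
    exact ⟨a, b, const 0, const 1, _, .inl rfl, not_lt.1 ha, not_lt.1 hb,
      by simpa [gates] using h, by simpa [gates] using h, by simp [eval]⟩
  | mul a b iha ihb =>
    by_cases ha : N < a.gates
    · exact (iha ha).context (k := b.gates + 1) (mul · b) b.eval 0
        (fun A => by simp only [gates]; lia) fun A => by simp only [eval]; ring
    by_cases hb : N < b.gates
    · exact (ihb hb).context (k := a.gates + 1) (mul a ·) a.eval 0
        (fun A => by simp only [gates]; lia) fun A => by simp only [eval]; ring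
    exact ⟨a, b, const 0, const 1, _, .inr rfl, not_lt.1 ha, not_lt.1 hb,
      by simpa [gates] using h, by simpa [gates] using h, by simp [eval]⟩

end Formula

theorem isMeasure_formulaLE : IsMeasure FormulaLE.{u} where
  mono := fun ⟨φ, h, hle⟩ hab => ⟨φ, h, hle.trans hab⟩
  varOrConst := by
    rintro K _ p (⟨j, rfl⟩ | ⟨c, rfl⟩)
    exacts [⟨.var j, rfl, le_rfl⟩, ⟨.const c, rfl, le_rfl⟩]
  add := by
    rintro K _ p q a b ⟨φ, rfl, hφ⟩ ⟨ψ, rfl, hψ⟩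
    exact ⟨.add φ ψ, rfl, by simp only [Formula.size]; lia⟩
  mul := by
    rintro K _ p q a (⟨j, rfl⟩ | ⟨c, rfl⟩) ⟨φ, rfl, hφ⟩
    exacts [⟨.mul (.var j) φ, rfl, by simp only [Formula.size]; lia⟩,
      ⟨.mul (.const c) φ, rfl, by simp only [Formula.size]; lia⟩]
  rename := by
    rintro K _ p a r ⟨φ, rfl, hφ⟩
    refine ⟨φ.subst (RingHom.id K) fun i => .var (r i), ?_, ?_⟩
    · rw [Formula.eval_subst, MvPolynomial.map_id]
      exact bind₁_X_comp r _
    · exact (φ.size_subst_le (k := 1) _ fun i => le_rfl).trans (by rwa [one_mul])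
  map := by
    rintro K L _ _ p a σ ⟨φ, rfl, hφ⟩
    refine ⟨φ.subst σ .var, ?_, ?_⟩
    · rw [Formula.eval_subst]
      exact DFunLike.congr_fun bind₁_X_left _
    · exact (φ.size_subst_le (k := 1) _ fun i => le_rfl).trans (by rwa [one_mul])
  deform := by
    rintro K _ p a e ⟨φ, rfl, hφ⟩
    refine ⟨φ.subst (RingHom.id K) fun i =>
      .add (.var i) (.mul (.const e) (.mul (.var i) (.var i))),
      ?_, ?_⟩
    · rw [Formula.eval_subst, MvPolynomial.map_id]
      rfl
    · exact (φ.size_subst_le (k := 7) _ fun i => le_rfl).trans (Nat.mul_le_mul_left 7 hφ)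

/-- The universal polynomials for formulas: `T (d + 1) = T d * T d + T d` with disjoint sets of
variables. -/
noncomputable def formulaUniversal (R : Type*) [CommSemiring R] : ℕ → MvPolynomial ℕ R
  | 0 => X 0
  | d + 1 => rename (3 * ·) (formulaUniversal R d) * rename (3 * · + 1) (formulaUniversal R d) +
      rename (3 * · + 2) (formulaUniversal R d)

theorem map_formulaUniversal {R S : Type*} [CommSemiring R] [CommSemiring S] (φ : R →+* S)
    (d : ℕ) : map φ (formulaUniversal R d) = formulaUniversal S d := by
  induction d with
  | zero => rw [formulaUniversal, formulaUniversal, map_X]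
  | succ d ih => simp only [formulaUniversal, map_add, map_mul, map_rename, ih]

section FormulaUniversal

variable {K : Type u} [Field K]

theorem formulaLE_formulaUniversal (d : ℕ) :
    FormulaLE K (formulaUniversal K d) (2 * 3 ^ d - 1) := by
  induction d with
  | zero => exact isMeasure_formulaLE.varOrConst (.X 0)
  | succ d ih =>
    obtain ⟨a, ha, hale⟩ := isMeasure_formulaLE.rename (3 * ·) ih
    obtain ⟨b, hb, hble⟩ := isMeasure_formulaLE.rename (3 * · + 1) ih
    obtain ⟨c, hc, hcle⟩ := isMeasure_formulaLE.rename (3 * · + 2) ih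
    refine ⟨.add (.mul a b) c, by simp only [Formula.eval, ha, hb, hc]; rfl, ?_⟩
    have : 0 < 3 ^ d := by positivity
    simp only [Formula.size, pow_succ]
    lia

theorem isProjection_formulaUniversal_mul_add {a b c : MvPolynomial ℕ K} {d : ℕ}
    (ha : IsProjection a (formulaUniversal K d)) (hb : IsProjection b (formulaUniversal K d))
    (hc : IsProjection c (formulaUniversal K d)) :
    IsProjection (a * b + c) (formulaUniversal K (d + 1)) := by
  rw [isProjection_iff] at *
  obtain ⟨α, hα, rfl⟩ := ha
  obtain ⟨β, hβ, rfl⟩ := hb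
  obtain ⟨γ, hγ, rfl⟩ := hc
  let δ : ℕ → MvPolynomial ℕ K := fun i =>
    if i % 3 = 0 then α (i / 3) else if i % 3 = 1 then β (i / 3) else γ (i / 3)
  have hδα : δ ∘ (3 * ·) = α := by
    funext i
    simp [δ]
  have hδβ : δ ∘ (3 * · + 1) = β := by
    funext i
    simp [δ, Nat.add_mod, show (3 * i + 1) / 3 = i by lia]
  have hδγ : δ ∘ (3 * · + 2) = γ := by
    funext i
    simp [δ, Nat.add_mod, show (3 * i + 2) / 3 = i by lia]
  refine ⟨δ, fun i => ?_, ?_⟩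
  · simp only [δ]
    split_ifs
    exacts [hα _, hβ _, hγ _]
  · rw [formulaUniversal, map_add, map_mul, bind₁_rename, bind₁_rename, bind₁_rename, hδα, hδβ,
      hδγ]

theorem IsVarOrConst.isProjection_formulaUniversal {p : MvPolynomial ℕ K} (hp : IsVarOrConst p)
    (d : ℕ) : IsProjection p (formulaUniversal K d) := by
  induction d generalizing p with
  | zero => exact ⟨fun _ => p, fun _ => hp, by rw [formulaUniversal, aeval_X]⟩
  | succ d ih => simpa using isProjection_formulaUniversal_mul_add (ih .zero) (ih .zero) (ih hp)

theorem IsProjection.formulaUniversal_succ {p : MvPolynomial ℕ K} {d : ℕ}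
    (hp : IsProjection p (formulaUniversal K d)) : IsProjection p (formulaUniversal K (d + 1)) := by
  have hzero := IsVarOrConst.zero.isProjection_formulaUniversal (K := K) d
  simpa using isProjection_formulaUniversal_mul_add hzero hzero hp

/-- Each separation halves the number of gates and costs two levels of `T`: one for the affine
dependence on the subformula, the other for the subformula and the slope. -/
theorem Formula.isProjection_formulaUniversal {k : ℕ} {φ : Formula K} (h : φ.gates < 2 ^ k) :
    IsProjection φ.eval (formulaUniversal K (2 * k)) := by
  induction k generalizing φ with
  | zero =>
    cases φ with
    | var i => exact (IsVarOrConst.X i).isProjection_formulaUniversal 0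
    | const c => exact (IsVarOrConst.C c).isProjection_formulaUniversal 0
    | add a b | mul a b => simp [gates] at h
  | succ k ih =>
    have : 2 ^ (k + 1) = 2 * 2 ^ k := pow_succ' 2 k
    obtain hgates | hgates := Nat.eq_zero_or_pos φ.gates
    · exact (ih (by rw [hgates]; positivity)).formulaUniversal_succ.formulaUniversal_succ
    obtain ⟨ψ₁, ψ₂, A₀, A₁, q, hq, hψ₁, hψ₂, hA₀, hA₁, hφ⟩ :=
      hasSeparator (N := φ.gates / 2) (φ := φ) (by lia)
    have hψ₁ := ih (φ := ψ₁) (by lia)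
    have hψ₂ := ih (φ := ψ₂) (by lia)
    have hA₀ := ih (φ := A₀) (by lia)
    have hA₁ := ih (φ := A₁) (by lia)
    rw [hφ, show 2 * (k + 1) = 2 * k + 1 + 1 by ring]
    refine isProjection_formulaUniversal_mul_add ?slope ?sub hA₀.formulaUniversal_succ
    case slope =>
      simpa [neg_add_eq_sub] using isProjection_formulaUniversal_mul_add hA₀
        ((IsVarOrConst.C (-1)).isProjection_formulaUniversal _) hA₁
    case sub =>
      rcases hq with rfl | rfl
      · simpa using isProjection_formulaUniversal_mul_add hψ₁
          (IsVarOrConst.one.isProjection_formulaUniversal _) hψ₂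
      · simpa using isProjection_formulaUniversal_mul_add hψ₁ hψ₂
          (IsVarOrConst.zero.isProjection_formulaUniversal _)

/-- The universal family for formulas: its `n`-th member has all formulas of size `n` as
projections. -/
noncomputable def formulaFamily (K : Type u) [Field K] : Family K := fun n =>
  formulaUniversal K (2 * (Nat.log 2 n + 1))

theorem lift_formulaFamily (n : ℕ) : lift (formulaFamily K n) = formulaFamily (RatFunc K) n :=
  map_formulaUniversal _ _

theorem formulaFamily_mem_VF : formulaFamily K ∈ VF K := by
  have hs : PolyBounded fun n => 2 * 3 ^ (2 * (Nat.log 2 n + 1)) - 1 := by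
    refine ⟨2 * (2 * (Polynomial.X + 1)) ^ 4, fun n => ?_⟩
    calc 2 * 3 ^ (2 * (Nat.log 2 n + 1)) - 1 ≤ 2 * (3 ^ 2) ^ (Nat.log 2 n + 1) :=
          (Nat.sub_le _ _).trans (by rw [pow_mul])
      _ ≤ 2 * (2 ^ 4) ^ (Nat.log 2 n + 1) :=
          Nat.mul_le_mul_left 2 (Nat.pow_le_pow_left (by norm_num) _)
      _ = 2 * (2 * 2 ^ Nat.log 2 n) ^ 4 := by rw [pow_right_comm, pow_succ' 2]
      _ ≤ 2 * (2 * (n + 1)) ^ 4 := by gcongr; exact Nat.pow_log_le_add_one 2 n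
      _ = _ := by simp
  have hU (n : ℕ) := formulaLE_formulaUniversal (K := K) (2 * (Nat.log 2 n + 1))
  refine ⟨⟨hs.mono fun n => ?_, hs.mono fun n => ?_⟩, _, hs, hU⟩ <;>
    obtain ⟨φ, h, hle⟩ := hU n <;> rw [formulaFamily, ← h]
  · exact φ.vars_card_eval_le.trans hle
  · exact φ.totalDegree_eval_le.trans hle

theorem pProjection_formulaFamily {g : Family K} (hg : g ∈ VF K) :
    PProjection g (formulaFamily K) := by
  obtain ⟨-, s, hs, h⟩ := hg
  refine ⟨s, hs, fun n => ?_⟩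
  obtain ⟨φ, hφ, hle⟩ := h n
  exact hφ ▸ φ.isProjection_formulaUniversal
    ((φ.gates_lt_size.trans_le hle).trans (Nat.lt_pow_succ_log_self one_lt_two _))

end FormulaUniversal

theorem isDenseIn_complete_VF (K : Type u) [Field K] (r : ReductionKind) :
    IsDenseIn (Complete VF r) VF K :=
  isDenseIn_complete isMeasure_formulaLE formulaFamily_mem_VF
    (fun _ hG => by simpa only [lift_formulaFamily] using pProjection_formulaFamily hG) r

theorem isDenseIn_diff_complete_VF (K : Type u) [Field K] :
    IsDenseIn (Diff VF (Complete VF .p)) VF K :=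
  isDenseIn_diff_complete isMeasure_formulaLE

/-! ### Straight-line programs -/

section StraightLine

variable {σ τ R R' : Type*} [CommSemiring R] [CommSemiring R']

/-- `IsStep sk S p`: one instruction of a straight-line program computes `p` from the polynomials
in `S`. If `sk` holds the program is skew: the first factor of a product is then a variable or a
constant. -/
inductive IsStep (sk : Prop) (S : Set (MvPolynomial σ R)) : MvPolynomial σ R → Prop
  | varOrConst {p : MvPolynomial σ R} (hp : IsVarOrConst p) : IsStep sk S p
  | add {p q : MvPolynomial σ R} (hp : p ∈ S) (hq : q ∈ S) : IsStep sk S (p + q)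
  | mul {p q : MvPolynomial σ R} (hsk : sk → IsVarOrConst p) (hp : p ∈ S) (hq : q ∈ S) :
      IsStep sk S (p * q)

/-- `StraightLine sk S n T`: given the polynomials in `S`, a straight-line program with `n`
instructions, skew if `sk` holds, computes all polynomials in `T`. -/
inductive StraightLine (sk : Prop) (S : Set (MvPolynomial σ R)) :
    ℕ → Set (MvPolynomial σ R) → Prop
  | refl : StraightLine sk S 0 S
  | insert {n : ℕ} {T : Set (MvPolynomial σ R)} {p : MvPolynomial σ R}
      (h : StraightLine sk S n T) (hp : IsStep sk T p) : StraightLine sk S (n + 1) (insert p T)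
  | subset {n : ℕ} {T T' : Set (MvPolynomial σ R)} (h : StraightLine sk S n T) (hT : T' ⊆ T) :
      StraightLine sk S n T'

variable {sk : Prop} {S T U : Set (MvPolynomial σ R)} {p q : MvPolynomial σ R} {n m : ℕ}

theorem IsStep.mono (h : IsStep sk S p) (hST : S ⊆ T) : IsStep sk T p := by
  cases h with
  | varOrConst hp => exact .varOrConst hp
  | add hp hq => exact .add (hST hp) (hST hq)
  | mul hsk hp hq => exact .mul hsk (hST hp) (hST hq)

theorem IsStep.image (h : IsStep sk S p) (φ : MvPolynomial σ R →+* MvPolynomial τ R')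
    (hφ : ∀ p, IsVarOrConst p → IsVarOrConst (φ p)) : IsStep sk (φ '' S) (φ p) := by
  cases h with
  | varOrConst hp => exact .varOrConst (hφ _ hp)
  | add hp hq => exact map_add φ _ _ ▸ .add ⟨_, hp, rfl⟩ ⟨_, hq, rfl⟩
  | mul hsk hp hq => exact map_mul φ _ _ ▸ .mul (fun h => hφ _ (hsk h)) ⟨_, hp, rfl⟩ ⟨_, hq, rfl⟩

namespace StraightLine

theorem mono (h : StraightLine sk S n T) (hnm : n ≤ m) : StraightLine sk S m T := by
  induction hnm with
  | refl => exact h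
  | step _ ih => exact (ih.insert (.varOrConst .zero)).subset (Set.subset_insert _ _)

theorem trans (hST : StraightLine sk S n T) (hTU : StraightLine sk T m U) :
    StraightLine sk S (n + m) U := by
  induction hTU with
  | refl => exact hST
  | insert _ hp ih => exact ih.insert hp
  | subset _ hT ih => exact ih.subset hT

theorem union_right (h : StraightLine sk S n T) (A : Set (MvPolynomial σ R)) :
    StraightLine sk (S ∪ A) n (T ∪ A) := by
  induction h with
  | refl => exact .refl
  | insert _ hp ih =>
    exact Set.insert_union ▸ ih.insert (hp.mono Set.subset_union_left)
  | subset _ hT ih => exact ih.subset (Set.union_subset_union_left A hT)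

theorem union (hS : StraightLine sk ∅ n S) (hT : StraightLine sk ∅ m T) :
    StraightLine sk ∅ (n + m) (S ∪ T) := by
  have hT := hT.union_right S
  rw [Set.empty_union, Set.union_comm] at hT
  exact hS.trans hT

theorem singleton_of_isVarOrConst (hp : IsVarOrConst p) : StraightLine sk ∅ 1 {p} :=
  (StraightLine.refl.insert (.varOrConst hp)).subset (Set.singleton_subset_iff.2 (.inl rfl))

theorem insert_image {ι : Type*} (I : Finset ι) (f : ι → MvPolynomial σ R)
    (hf : ∀ i ∈ I, StraightLine sk S m (Insert.insert (f i) S)) :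
    StraightLine sk S (I.card * m) (S ∪ f '' I) := by
  classical
  induction I using Finset.induction_on with
  | empty => simpa using refl
  | insert a I ha ih =>
    have hI := ih fun i hi => hf i (Finset.mem_insert_of_mem hi)
    have ha' := (hf a (Finset.mem_insert_self a I)).union_right (f '' I)
    rw [Finset.card_insert_of_notMem ha, add_one_mul, Finset.coe_insert, Set.image_insert_eq,
      Set.union_insert, ← Set.insert_union]
    exact hI.trans ha'

theorem insert_sum {ι : Type*} (I : Finset ι) (f : ι → MvPolynomial σ R)
    (hf : ∀ i ∈ I, IsStep sk S (f i)) :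
    StraightLine sk S (2 * I.card + 1) (Insert.insert (∑ i ∈ I, f i) S) := by
  classical
  induction I using Finset.induction_on with
  | empty => exact refl.insert (.varOrConst .zero)
  | insert a I ha ih =>
    have hI := ih fun i hi => hf i (Finset.mem_insert_of_mem hi)
    have hfa := (hf a (Finset.mem_insert_self a I)).mono (Set.subset_insert (∑ i ∈ I, f i) S)
    rw [Finset.sum_insert ha, Finset.card_insert_of_notMem ha]
    exact ((hI.insert hfa).insert (.add (.inl rfl) (.inr (.inl rfl)))).subset
      (Set.insert_subset_insert ((Set.subset_insert _ _).trans (Set.subset_insert _ _)))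

theorem image (h : StraightLine sk S n T) (φ : MvPolynomial σ R →+* MvPolynomial τ R')
    (hφ : ∀ p, IsVarOrConst p → IsVarOrConst (φ p)) : StraightLine sk (φ '' S) n (φ '' T) := by
  induction h with
  | refl => exact .refl
  | insert _ hp ih => exact Set.image_insert_eq ▸ ih.insert (hp.image φ hφ)
  | subset _ hT ih => exact ih.subset (Set.image_mono hT)

theorem exists_vars_subset (h : StraightLine sk (∅ : Set (MvPolynomial σ R)) n T) :
    ∃ V : Finset σ, V.card ≤ n ∧ ∀ p ∈ T, p.vars ⊆ V := by
  classical
  induction h with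
  | refl => exact ⟨∅, le_rfl, fun _ hp => hp.elim⟩
  | @insert n T p _ hp ih =>
    obtain ⟨V, hV, hT⟩ := ih
    have hVp : ∃ W : Finset σ, W.card ≤ 1 ∧ p.vars ⊆ V ∪ W := by
      cases hp with
      | varOrConst hp => exact ⟨p.vars, hp.vars_card_le, Finset.subset_union_right⟩
      | add hp hq => exact ⟨∅, Nat.zero_le _, (vars_add_subset _ _).trans
          ((Finset.union_subset (hT _ hp) (hT _ hq)).trans Finset.subset_union_left)⟩
      | mul _ hp hq => exact ⟨∅, Nat.zero_le _, (vars_mul _ _).trans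
          ((Finset.union_subset (hT _ hp) (hT _ hq)).trans Finset.subset_union_left)⟩
    obtain ⟨W, hW, hpW⟩ := hVp
    refine ⟨V ∪ W, (Finset.card_union_le _ _).trans (add_le_add hV hW), ?_⟩
    exact Set.forall_mem_insert.2
      ⟨hpW, fun q hq => (hT q hq).trans Finset.subset_union_left⟩
  | subset _ hT ih =>
    obtain ⟨V, hV, hTV⟩ := ih
    exact ⟨V, hV, fun p hp => hTV p (hT hp)⟩

theorem vars_card_le (h : StraightLine sk ∅ n {p}) : p.vars.card ≤ n := by
  obtain ⟨V, hV, hp⟩ := h.exists_vars_subset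
  exact (Finset.card_le_card (hp p rfl)).trans hV

theorem totalDegree_le_of_mem (h : StraightLine True ∅ n T) : ∀ p ∈ T, p.totalDegree ≤ n := by
  induction h with
  | refl => exact fun _ hp => hp.elim
  | insert _ hp ih =>
    refine Set.forall_mem_insert.2 ⟨?_, fun q hq => (ih q hq).trans (Nat.le_succ _)⟩
    cases hp with
    | varOrConst hp => exact hp.totalDegree_le.trans (Nat.le_add_left _ _)
    | @add p q hp hq =>
      have hp := ih _ hp
      have hq := ih _ hq
      exact (totalDegree_add p q).trans (by lia)
    | @mul p q hsk _ hq =>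
      have hp := (hsk trivial).totalDegree_le
      have hq := ih _ hq
      exact (totalDegree_mul p q).trans (by lia)
  | subset _ hT ih => exact fun p hp => ih p (hT hp)

end StraightLine

/-! ### Instruction sequences -/

/-- `v 0, …, v (n - 1)` are the successive results of a straight-line program. -/
def IsStepSequence (sk : Prop) (n : ℕ) (v : ℕ → MvPolynomial σ R) : Prop :=
  ∀ k < n, IsStep sk (v '' Set.Iio k) (v k)

theorem IsStepSequence.exists_snoc {v : ℕ → MvPolynomial σ R} (hv : IsStepSequence sk n v)
    (hp : IsStep sk (v '' Set.Iio n) p) :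
    ∃ w, IsStepSequence sk (n + 1) w ∧ w n = p ∧ w '' Set.Iio n = v '' Set.Iio n := by
  have himage (k : ℕ) (hk : k ≤ n) :
      Function.update v n p '' Set.Iio k = v '' Set.Iio k :=
    Set.image_congr fun i hi => Function.update_of_ne (ne_of_lt (lt_of_lt_of_le hi hk)) _ _
  refine ⟨Function.update v n p, fun k hk => ?_, Function.update_self _ _ _, himage n le_rfl⟩
  rw [himage k (Nat.lt_succ_iff.1 hk)]
  rcases (Nat.lt_succ_iff.1 hk).eq_or_lt with rfl | hk
  · rwa [Function.update_self]
  · rw [Function.update_of_ne hk.ne]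
    exact hv k hk

namespace StraightLine

theorem exists_isStepSequence (h : StraightLine sk (∅ : Set (MvPolynomial σ R)) n T) :
    ∃ v, IsStepSequence sk n v ∧ T ⊆ v '' Set.Iio n := by
  induction h with
  | refl => exact ⟨0, fun _ hk => absurd hk (Nat.not_lt_zero _), Set.empty_subset _⟩
  | @insert n T p _ hp ih =>
    obtain ⟨v, hv, hT⟩ := ih
    obtain ⟨w, hw, hwp, himage⟩ := hv.exists_snoc (hp.mono hT)
    refine ⟨w, hw, Set.insert_subset ⟨n, Nat.lt_succ_self n, hwp⟩ ?_⟩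
    exact hT.trans (himage ▸ Set.image_mono (Set.Iio_subset_Iio (Nat.le_succ n)))
  | subset _ hT ih =>
    obtain ⟨v, hv, hTv⟩ := ih
    exact ⟨v, hv, hT.trans hTv⟩

theorem exists_isStepSequence_eq (h : StraightLine sk ∅ n {p}) :
    ∃ v, IsStepSequence sk (n + 2) v ∧ v (n + 1) = p := by
  obtain ⟨v, hv, hT⟩ := (h.insert (.varOrConst .zero)).exists_isStepSequence
  have hp : IsStep sk (v '' Set.Iio (n + 1)) p :=
    add_zero p ▸ .add (hT (.inr rfl)) (hT (.inl rfl))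
  obtain ⟨w, hw, hwp, -⟩ := hv.exists_snoc hp
  exact ⟨w, hw, hwp⟩

end StraightLine

end StraightLine

section Deformation

variable {R : Type*} [CommRing R] {sk : Prop} {T : Set (MvPolynomial ℕ R)} {n : ℕ}

theorem straightLine_deform_X (sk : Prop) (e : R) (i : ℕ) (S : Set (MvPolynomial ℕ R)) :
    StraightLine sk S 5 (insert (deform e (X i)) S) := by
  have h₁ := (StraightLine.refl (sk := sk) (S := S)).insert (.varOrConst (.X i))
  have h₂ := h₁.insert (.mul (fun _ => .X i) (.inl rfl) (.inl rfl))
  have h₃ := h₂.insert (.varOrConst (.C e))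
  have h₄ := h₃.insert (.mul (fun _ => .C e) (.inl rfl) (.inr (.inl rfl)))
  have h₅ := h₄.insert (p := deform e (X i))
    (deform_X e i ▸ .add (.inr (.inr (.inr (.inl rfl)))) (.inl rfl))
  exact h₅.subset (Set.insert_subset_insert fun q hq => by simp [hq])

/-- In a skew program `xᵢ + e xᵢ²` is not an admissible factor, but its product with `q` can be
computed as `xᵢ q + e (xᵢ (xᵢ q))`. -/
theorem straightLine_deform_X_mul (sk : Prop) (e : R) (i : ℕ) {S : Set (MvPolynomial ℕ R)}
    {q : MvPolynomial ℕ R} (hq : q ∈ S) :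
    StraightLine sk S 6 (insert (deform e (X i) * q) S) := by
  have h₁ := (StraightLine.refl (sk := sk) (S := S)).insert (.varOrConst (.X i))
  have h₂ := h₁.insert (.mul (fun _ => .X i) (.inl rfl) (.inr hq))
  have h₃ := h₂.insert (.mul (fun _ => .X i) (.inr (.inl rfl)) (.inl rfl))
  have h₄ := h₃.insert (.varOrConst (.C e))
  have h₅ := h₄.insert (.mul (fun _ => .C e) (.inl rfl) (.inr (.inl rfl)))
  have h₆ := h₅.insert (.add (.inr (.inr (.inr (.inl rfl)))) (.inl rfl))
  rw [show deform e (X i) * q = X i * q + C e * (X i * (X i * q)) by rw [deform_X]; ring]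
  exact h₆.subset (Set.insert_subset_insert fun q hq => by simp [hq])

theorem IsStep.deform {p : MvPolynomial ℕ R} (h : IsStep sk T p) (e : R) :
    StraightLine sk (deform e '' T) 7 (insert (deform e p) (deform e '' T)) := by
  set D := AlgComplexity.deform e '' T
  have single {q : MvPolynomial ℕ R} (hq : IsStep sk D q) : StraightLine sk D 7 (insert q D) :=
    (StraightLine.refl.insert hq).mono (by lia)
  cases h with
  | add hp hq =>
    rw [map_add]
    exact single (.add ⟨_, hp, rfl⟩ ⟨_, hq, rfl⟩)
  | varOrConst hp =>
    rcases hp with ⟨i, rfl⟩ | ⟨c, rfl⟩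
    · exact (straightLine_deform_X sk e i D).mono (by lia)
    · rw [deform_C]
      exact single (.varOrConst (.C c))
  | @mul p q hsk hp hq =>
    have hp : AlgComplexity.deform e p ∈ D := ⟨p, hp, rfl⟩
    have hq : AlgComplexity.deform e q ∈ D := ⟨q, hq, rfl⟩
    rw [map_mul]
    by_cases h : sk
    · rcases hsk h with ⟨i, rfl⟩ | ⟨c, rfl⟩
      · exact (straightLine_deform_X_mul sk e i hq).mono (by lia)
      · rw [deform_C] at hp ⊢
        exact single (.mul (fun _ => .C c) hp hq)
    · exact single (.mul (fun hs => absurd hs h) hp hq)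

theorem StraightLine.deform (h : StraightLine sk ∅ n T) (e : R) :
    StraightLine sk ∅ (7 * n) (deform e '' T) := by
  induction h with
  | refl => exact (Set.image_empty _).symm ▸ .refl
  | insert _ hp ih => exact Set.image_insert_eq ▸ ih.trans (hp.deform e)
  | subset _ hT ih => exact ih.subset (Set.image_mono hT)

end Deformation

/-! ### Straight-line programs and circuits -/

section Circuits

theorem finset_univ_induction_of_wellFounded {V : Type*} [Fintype V] [DecidableEq V]
    {r : V → V → Prop} (hr : WellFounded r) {P : Finset V → Prop} (empty : P ∅)
    (insert : ∀ D m, m ∉ D → (∀ u, r u m → u ∈ D) → P D → P (insert m D)) : P Finset.univ := by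
  have hP (k : ℕ) (hk : k ≤ Fintype.card V) : ∃ D : Finset V, D.card = k ∧ P D := by
    induction k with
    | zero => exact ⟨∅, rfl, empty⟩
    | succ k ih =>
      obtain ⟨D, hD, hPD⟩ := ih (by lia)
      obtain ⟨v, -, hv⟩ := Finset.exists_mem_notMem_of_card_lt_card
        (s := D) (t := Finset.univ) (by rw [hD, Finset.card_univ]; lia)
      obtain ⟨m, hm, hmin⟩ := hr.has_min {v | v ∉ D} ⟨v, hv⟩
      exact ⟨_, by rw [Finset.card_insert_of_notMem hm, hD],
        insert D m hm (fun u hu => by_contra fun h => hmin u h hu) hPD⟩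
  obtain ⟨D, hD, hPD⟩ := hP _ le_rfl
  rwa [(Finset.card_eq_iff_eq_univ D).1 hD] at hPD

variable {K : Type u} [Field K] {sk : Prop} {n : ℕ} {p : MvPolynomial ℕ K}

theorem Gate.IsLeaf.isVarOrConst_value {S : Set (MvPolynomial ℕ K)} {V : Type} {γ : Gate S V}
    (h : γ.IsLeaf) (val : V → MvPolynomial ℕ K) : IsVarOrConst (γ.value val) := by
  cases γ with
  | var i => exact .X i
  | const c => exact .C c
  | _ => exact h.elim

theorem Circuit.isStep_value {c : Circuit (∅ : Set (MvPolynomial ℕ K))} (hsk : sk → c.IsSkew)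
    {val : c.Node → MvPolynomial ℕ K} (hval : ∀ v, val v = (c.gate v).value val)
    {D : Set c.Node} {m : c.Node} (hD : ∀ u, (c.gate m).HasInput u → u ∈ D) :
    IsStep sk (val '' D) (val m) := by
  have hleaf {a : c.Node} (ha : (c.gate a).IsLeaf) : IsVarOrConst (val a) :=
    hval a ▸ ha.isVarOrConst_value val
  rw [hval m]
  cases hm : c.gate m with
  | var i => exact .varOrConst (.X i)
  | const a => exact .varOrConst (.C a)
  | oracle g h args => exact h.elim
  | add a b =>
    rw [hm] at hD
    exact .add ⟨a, hD a (.inl rfl), rfl⟩ ⟨b, hD b (.inr rfl), rfl⟩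
  | mul a b =>
    rw [hm] at hD
    have ha : val a ∈ val '' D := ⟨a, hD a (.inl rfl), rfl⟩
    have hb : val b ∈ val '' D := ⟨b, hD b (.inr rfl), rfl⟩
    by_cases hla : (c.gate a).IsLeaf
    · exact .mul (fun _ => hleaf hla) ha hb
    · rw [Gate.value, mul_comm]
      exact .mul (fun h => hleaf ((hsk h m a b hm).resolve_left hla)) hb ha

theorem Circuit.straightLine (c : Circuit (∅ : Set (MvPolynomial ℕ K))) (hc : c.Computes p)
    (hsk : sk → c.IsSkew) : StraightLine sk ∅ c.size {p} := by
  classical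
  obtain ⟨val, hval, rfl⟩ := hc
  let _ := c.fintypeNode
  have huniv : StraightLine sk ∅ (Finset.univ : Finset c.Node).card
      (val '' (Finset.univ : Finset c.Node)) := by
    refine finset_univ_induction_of_wellFounded c.acyclic
      (P := fun D => StraightLine sk ∅ D.card (val '' D)) ?_ fun D m hm hinput ih => ?_
    · simpa using StraightLine.refl
    · rw [Finset.card_insert_of_notMem hm, Finset.coe_insert, Set.image_insert_eq]
      exact ih.insert (c.isStep_value hsk hval hinput)
  exact huniv.subset
    (Set.singleton_subset_iff.2 ⟨c.root, Finset.mem_coe.2 (Finset.mem_univ _), rfl⟩)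

theorem IsStepSequence.exists_gate {v : ℕ → MvPolynomial ℕ K} (hv : IsStepSequence sk n v)
    (k : Fin n) : ∃ γ : Gate (∅ : Set (MvPolynomial ℕ K)) (Fin n),
      (∀ u, γ.HasInput u → u < k) ∧ v k = γ.value (fun i : Fin n => v i) ∧
      (IsVarOrConst (v k) → γ.IsLeaf) ∧ (∀ a b, γ = .mul a b → sk → IsVarOrConst (v a)) := by
  by_cases hk : IsVarOrConst (v k)
  · obtain ⟨γ, hleaf, hinput, hval⟩ := hk.exists_gate ∅ (Fin n)
    refine ⟨γ, fun u hu => absurd hu (hinput u), (hval _).symm, fun _ => hleaf, ?_⟩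
    rintro a b rfl
    exact hleaf.elim
  generalize hp : v k = p at hk ⊢
  cases hp ▸ hv k k.2 with
  | varOrConst h => exact absurd h hk
  | add ha hb =>
    obtain ⟨i, hi, rfl⟩ := ha
    obtain ⟨j, hj, rfl⟩ := hb
    refine ⟨.add ⟨i, lt_trans hi k.2⟩ ⟨j, lt_trans hj k.2⟩, ?_, rfl, fun h => absurd h hk,
      fun a b h => by cases h⟩
    rintro u (rfl | rfl)
    exacts [hi, hj]
  | mul hsk ha hb =>
    obtain ⟨i, hi, rfl⟩ := ha
    obtain ⟨j, hj, rfl⟩ := hb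
    refine ⟨.mul ⟨i, lt_trans hi k.2⟩ ⟨j, lt_trans hj k.2⟩, ?_, rfl, fun h => absurd h hk, ?_⟩
    · rintro u (rfl | rfl)
      exacts [hi, hj]
    · intro a b h
      cases h
      exact hsk

theorem StraightLine.exists_circuit (h : StraightLine sk ∅ n {p}) :
    ∃ c : Circuit (∅ : Set (MvPolynomial ℕ K)),
      (sk → c.IsSkew) ∧ c.Computes p ∧ c.size ≤ n := by
  obtain ⟨v, hv, hp⟩ := h.exists_isStepSequence
  obtain ⟨r, hr, hvr⟩ := hp rfl
  choose γ hlt hval hleaf hmul using hv.exists_gate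
  refine ⟨⟨Fin n, inferInstance, γ,
    Subrelation.wf (fun {a b} h => hlt b a h) (wellFounded_lt (α := Fin n)), ⟨r, hr⟩⟩,
    fun hsk k a b hk => .inl (hleaf a (hmul k a b hk hsk)), ⟨fun i => v i, hval, hvr⟩, ?_⟩
  exact (Fintype.card_fin n).le

end Circuits

/-- Some (skew, if `sk` holds) straight-line program with `n` instructions computes `p`. -/
def StraightLineLE (sk : Prop) (K : Type u) [Field K] (p : MvPolynomial ℕ K) (n : ℕ) : Prop :=
  StraightLine sk ∅ n {p}

theorem VP_eq_classOf : (VP.{u} : ComplexityClass.{u}) = classOf (StraightLineLE False) := by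
  funext K _
  ext f
  refine and_congr_right fun _ => exists_congr fun s => and_congr_right fun _ =>
    forall_congr' fun n => ⟨fun ⟨c, hc, hle⟩ => (c.straightLine hc False.elim).mono hle,
      fun h => ?_⟩
  obtain ⟨c, -, hc⟩ := StraightLine.exists_circuit h
  exact ⟨c, hc⟩

theorem VBP_eq_classOf : (VBP.{u} : ComplexityClass.{u}) = classOf (StraightLineLE True) := by
  funext K _
  ext f
  refine and_congr_right fun _ => exists_congr fun s => and_congr_right fun _ =>
    forall_congr' fun n => ⟨fun ⟨c, hsk, hc, hle⟩ => (c.straightLine hc fun _ => hsk).mono hle,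
      fun h => ?_⟩
  obtain ⟨c, hsk, hc⟩ := StraightLine.exists_circuit h
  exact ⟨c, hsk trivial, hc⟩

theorem isMeasure_straightLineLE (sk : Prop) : IsMeasure (StraightLineLE.{u} sk) where
  mono := StraightLine.mono
  varOrConst := StraightLine.singleton_of_isVarOrConst
  add := fun hp hq => ((StraightLine.union hp hq).insert
    (.add (.inl rfl) (.inr rfl))).subset (Set.singleton_subset_iff.2 (.inl rfl))
  mul := fun hq hp => ((StraightLine.insert hp (.varOrConst hq)).insert
    (.mul (fun _ => hq) (.inl rfl) (.inr rfl))).subset (Set.singleton_subset_iff.2 (.inl rfl))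
  rename := fun φ h => by
    simpa [StraightLineLE, bind₁_X_comp] using StraightLine.image h
      (bind₁ fun i => X (φ i) : MvPolynomial ℕ _ →ₐ[_] _).toRingHom
      fun p hp => hp.bind₁ fun i => .X (φ i)
  map := fun φ h => by
    simpa [StraightLineLE] using StraightLine.image h (MvPolynomial.map φ) fun p hp => hp.map φ
  deform := fun e h => by
    simpa [StraightLineLE] using StraightLine.deform h e

/-! ### Universal polynomials for skew circuits -/

section SkewUniversal

variable {R S : Type*} [CommSemiring R] [CommSemiring S]

/-- The universal polynomials for skew straight-line programs: the `k`-th one is an arbitrary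
affine combination of its predecessors, with coefficients that are variables of its own. -/
noncomputable def skewUniversal (R : Type*) [CommSemiring R] (k : ℕ) : MvPolynomial ℕ R :=
  X (Nat.pair k k) + ∑ j : Fin k, X (Nat.pair k j) * skewUniversal R j

theorem skewUniversal_eq (k : ℕ) : skewUniversal R k = X (Nat.pair k k) +
    ∑ j ∈ Finset.range k, X (Nat.pair k j) * skewUniversal R j := by
  rw [skewUniversal, Finset.sum_range]

theorem map_skewUniversal (φ : R →+* S) (k : ℕ) :
    map φ (skewUniversal R k) = skewUniversal S k := by
  induction k using Nat.strong_induction_on with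
  | _ k ih =>
    rw [skewUniversal_eq, skewUniversal_eq, map_add, map_sum, map_X]
    refine congrArg _ (Finset.sum_congr rfl fun j hj => ?_)
    rw [map_mul, map_X, ih j (Finset.mem_range.1 hj)]

theorem straightLine_skewUniversal_image_Iio (k : ℕ) :
    StraightLine True ∅ (3 * k * k) (skewUniversal R '' Set.Iio k) := by
  induction k with
  | zero => simpa using StraightLine.refl
  | succ k ih =>
    set T := skewUniversal R '' Set.Iio k with hT
    set V : Set (MvPolynomial ℕ R) := (fun j => X (Nat.pair k j)) '' (Finset.range (k + 1) : Set ℕ)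
    have hV (j : ℕ) (hj : j < k + 1) : X (Nat.pair k j) ∈ T ∪ V :=
      .inr ⟨j, Finset.mem_coe.2 (Finset.mem_range.2 hj), rfl⟩
    have coefficients := StraightLine.insert_image (sk := True) (S := T) (Finset.range (k + 1))
      (fun j => X (Nat.pair k j)) fun j _ => StraightLine.refl.insert (.varOrConst (.X _))
    have linear := StraightLine.insert_sum (sk := True) (S := T ∪ V) (Finset.range k)
      (fun j => X (Nat.pair k j) * skewUniversal R j) fun j hj =>
        .mul (fun _ => .X _) (hV j ((Finset.mem_range.1 hj).trans k.lt_succ_self))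
          (.inl ⟨j, Finset.mem_range.1 hj, rfl⟩)
    have sum := ((ih.trans coefficients).trans linear).insert
      (.add (.inr (hV k k.lt_succ_self)) (.inl rfl))
    rw [← skewUniversal_eq, Finset.card_range, Finset.card_range] at sum
    rw [← Order.succ_eq_add_one, Order.Iio_succ_eq_insert, Set.image_insert_eq, ← hT]
    refine (sum.mono ?_).subset (Set.insert_subset_insert fun p hp => .inr (.inl hp))
    simp only [Order.succ_eq_add_one]
    lia

theorem straightLine_skewUniversal (k : ℕ) :
    StraightLine True ∅ (3 * (k + 1) * (k + 1)) {skewUniversal R k} :=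
  (straightLine_skewUniversal_image_Iio (k + 1)).subset
    (Set.singleton_subset_iff.2 ⟨k, k.lt_succ_self, rfl⟩)

theorem IsStep.exists_affine_combination {v : ℕ → MvPolynomial ℕ R} {k : ℕ}
    {p : MvPolynomial ℕ R} (h : IsStep True (v '' Set.Iio k) p) :
    ∃ y : ℕ → MvPolynomial ℕ R, (∀ j, IsVarOrConst (y j)) ∧
      p = y k + ∑ j ∈ Finset.range k, y j * v j := by
  cases h with
  | varOrConst hp =>
    refine ⟨fun j => if j = k then p else 0, fun j => ?_, ?_⟩
    · dsimp only
      split_ifs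
      exacts [hp, .zero]
    · simp [ite_mul]
  | add hp hq =>
    obtain ⟨a, ha, rfl⟩ := hp
    obtain ⟨b, hb, rfl⟩ := hq
    rw [Set.mem_Iio] at ha hb
    refine ⟨fun j => C ((if j = a then 1 else 0) + (if j = b then 1 else 0)), fun j => .C _, ?_⟩
    simp [add_mul, Finset.sum_add_distrib, apply_ite C, ite_mul, ha, hb, ha.ne', hb.ne']
  | @mul p _ hsk _ hq =>
    obtain ⟨b, hb, rfl⟩ := hq
    rw [Set.mem_Iio] at hb
    refine ⟨fun j => if j = b then p else 0, fun j => ?_, ?_⟩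
    · dsimp only
      split_ifs
      exacts [hsk trivial, .zero]
    · simp [ite_mul, hb, hb.ne']

end SkewUniversal

section SkewFamily

variable {K : Type u} [Field K]

theorem IsStepSequence.isProjection_skewUniversal {v : ℕ → MvPolynomial ℕ K} {n : ℕ}
    (hv : IsStepSequence True n v) {k : ℕ} (hk : k < n) :
    IsProjection (v k) (skewUniversal K k) := by
  have hcoeff (k : ℕ) : ∃ y : ℕ → MvPolynomial ℕ K, (∀ j, IsVarOrConst (y j)) ∧
      (k < n → v k = y k + ∑ j ∈ Finset.range k, y j * v j) := by
    by_cases hk : k < n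
    · obtain ⟨y, hy, h⟩ := (hv k hk).exists_affine_combination
      exact ⟨y, hy, fun _ => h⟩
    · exact ⟨0, fun _ => .zero, fun h => absurd h hk⟩
  choose y hy hvy using hcoeff
  refine isProjection_iff.2 ⟨fun i => y i.unpair.1 i.unpair.2, fun i => hy _ _, ?_⟩
  induction k using Nat.strong_induction_on with
  | _ k ih =>
    rw [hvy k hk, skewUniversal_eq, map_add, map_sum, bind₁_X_right, Nat.unpair_pair]
    refine congrArg _ (Finset.sum_congr rfl fun j hj => ?_)
    have hj := Finset.mem_range.1 hj
    rw [map_mul, bind₁_X_right, Nat.unpair_pair, ih j hj (hj.trans hk)]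

theorem skewUniversal_mem_VBP : skewUniversal K ∈ VBP K := by
  rw [VBP_eq_classOf]
  have hs : PolyBounded fun n => 3 * (n + 1) * (n + 1) :=
    ((PolyBounded.const 3).mul (.add .id (.const 1))).mul (.add .id (.const 1))
  exact ⟨⟨hs.mono fun n => (straightLine_skewUniversal n).vars_card_le,
    hs.mono fun n => (straightLine_skewUniversal n).totalDegree_le_of_mem _ rfl⟩,
    _, hs, straightLine_skewUniversal⟩

theorem pProjection_skewUniversal {g : Family K} (hg : g ∈ VBP K) :
    PProjection g (skewUniversal K) := by
  rw [VBP_eq_classOf] at hg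
  obtain ⟨-, s, hs, h⟩ := hg
  refine ⟨fun n => s n + 1, hs.add (.const 1), fun n => ?_⟩
  obtain ⟨v, hv, hvn⟩ := (h n).exists_isStepSequence_eq
  exact hvn ▸ hv.isProjection_skewUniversal (by lia)

end SkewFamily

theorem isDenseIn_complete_VBP (K : Type u) [Field K] (r : ReductionKind) :
    IsDenseIn (Complete VBP r) VBP K := by
  have hmem := skewUniversal_mem_VBP (K := K)
  have huniv (G) := pProjection_skewUniversal (K := RatFunc K) (g := G)
  rw [VBP_eq_classOf] at *
  refine isDenseIn_complete (isMeasure_straightLineLE True) hmem (fun G hG => ?_) r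
  simpa only [lift, map_skewUniversal] using huniv G hG

theorem isDenseIn_diff_complete_VBP (K : Type u) [Field K] :
    IsDenseIn (Diff VBP (Complete VBP .p)) VBP K := by
  rw [VBP_eq_classOf]
  exact isDenseIn_diff_complete (isMeasure_straightLineLE True)

/-! ### Universal polynomials for circuits -/

section HomogeneousComponent

variable {σ R : Type*} [CommSemiring R]

theorem homogeneousComponent_mul (p q : MvPolynomial σ R) (d : ℕ) :
    homogeneousComponent d (p * q) = ∑ x ∈ Finset.HasAntidiagonal.antidiagonal d,
      homogeneousComponent x.1 p * homogeneousComponent x.2 q := by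
  let _ := gradedAlgebra (σ := σ) (R := R)
  have hdecompose (p : MvPolynomial σ R) (i : ℕ) : homogeneousComponent i p =
      DirectSum.decompose (homogeneousSubmodule σ R) p i :=
        (decomposition.decompose'_apply p i).symm
  simp only [hdecompose, DirectSum.decompose_mul, DirectSum.coe_mul_apply_eq_sum_antidiagonal]

theorem homogeneousComponent_mul_of_pos (p q : MvPolynomial σ R) {d : ℕ} (hd : 1 ≤ d) :
    homogeneousComponent d (p * q) =
      C (coeff 0 p) * homogeneousComponent d q + C (coeff 0 q) * homogeneousComponent d p +
        ∑ e ∈ Finset.Ico 1 d, homogeneousComponent e p * homogeneousComponent (d - e) q := by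
  rw [homogeneousComponent_mul, Finset.Nat.sum_antidiagonal_eq_sum_range_succ
      (fun i j => homogeneousComponent i p * homogeneousComponent j q),
    Finset.sum_range_succ, Finset.range_eq_Ico, Finset.sum_eq_sum_Ico_succ_bot (by lia),
    Nat.sub_zero, Nat.sub_self, homogeneousComponent_zero, homogeneousComponent_zero]
  ring

theorem eq_C_add_sum_homogeneousComponent {p : MvPolynomial σ R} {n : ℕ}
    (hp : p.totalDegree ≤ n) :
    p = C (coeff 0 p) + ∑ d ∈ Finset.Icc 1 n, homogeneousComponent d p := by
  have hsubset : Finset.range (p.totalDegree + 1) ⊆ Finset.range (n + 1) :=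
    Finset.range_mono (by lia)
  conv_lhs => rw [← sum_homogeneousComponent p]
  rw [Finset.sum_subset hsubset fun d _ hd => homogeneousComponent_eq_zero _ _
      (by rw [Finset.mem_range] at hd; lia),
    Finset.range_eq_Ico, Finset.sum_eq_sum_Ico_succ_bot n.succ_pos, homogeneousComponent_zero]
  rfl

end HomogeneousComponent

section CircuitUniversal

variable {R S : Type*} [CommSemiring R] [CommSemiring S]

/-- The index of the coefficient variable of kind `c` that the `k`-th instruction of the universal
circuit attaches to the result of the `j`-th instruction. -/
def circuitVar (c k j : ℕ) : ℕ := Nat.pair c (Nat.pair k j)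

/-- The universal polynomials for the homogeneous components of degree `d ≥ 1` in a straight-line
program: the `k`-th instruction adds an arbitrary linear combination of its predecessors to the
product of two others. In degree `d` this product contributes its terms of mixed degrees `e` and
`d - e`; those involving a constant coefficient are accounted for by the linear combination. -/
noncomputable def circuitUniversal (R : Type*) [CommSemiring R] (k : ℕ) : ℕ → MvPolynomial ℕ R :=
  fun d => (if d = 1 then X (circuitVar 0 k 0) else 0) +
    ∑ j : Fin k, X (circuitVar 1 k j) * circuitUniversal R j d +
    ∑ e ∈ Finset.Ico 1 d, (∑ j : Fin k, X (circuitVar 2 k j) * circuitUniversal R j e) *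
      ∑ j : Fin k, X (circuitVar 3 k j) * circuitUniversal R j (d - e)
termination_by k
decreasing_by all_goals exact j.2

/-- The generic linear combination, with coefficients of kind `c`, of the degree `d` polynomials
preceding the `k`-th instruction of the universal circuit. -/
noncomputable def circuitLinear (R : Type*) [CommSemiring R] (c k d : ℕ) : MvPolynomial ℕ R :=
  ∑ j ∈ Finset.range k, X (circuitVar c k j) * circuitUniversal R j d

/-- The universal family for circuits: its `n`-th member has the polynomials of degree at most `n`
which a straight-line program computes in its `n`-th instruction as projections. -/
noncomputable def circuitFamily (R : Type*) [CommSemiring R] (n : ℕ) : MvPolynomial ℕ R :=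
  X (circuitVar 4 0 0) + ∑ d ∈ Finset.Icc 1 n, circuitUniversal R n d

theorem circuitUniversal_eq (k d : ℕ) :
    circuitUniversal R k d = (if d = 1 then X (circuitVar 0 k 0) else 0) +
      circuitLinear R 1 k d +
      ∑ e ∈ Finset.Ico 1 d, circuitLinear R 2 k e * circuitLinear R 3 k (d - e) := by
  rw [circuitUniversal]
  simp only [circuitLinear, Finset.sum_range]

theorem map_circuitUniversal (φ : R →+* S) (k d : ℕ) :
    map φ (circuitUniversal R k d) = circuitUniversal S k d := by
  induction k using Nat.strong_induction_on generalizing d with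
  | _ k ih =>
    have hlinear (c d : ℕ) : map φ (circuitLinear R c k d) = circuitLinear S c k d := by
      rw [circuitLinear, circuitLinear, map_sum]
      refine Finset.sum_congr rfl fun j hj => ?_
      rw [map_mul, map_X, ih j (Finset.mem_range.1 hj)]
    simp only [circuitUniversal_eq, map_add, map_sum, map_mul, hlinear, apply_ite (map φ), map_X,
      map_zero]

theorem map_circuitFamily (φ : R →+* S) (n : ℕ) :
    map φ (circuitFamily R n) = circuitFamily S n := by
  simp only [circuitFamily, map_add, map_X, map_sum, map_circuitUniversal]

theorem totalDegree_circuitLinear_le {c k d b : ℕ}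
    (h : ∀ j < k, (circuitUniversal R j d).totalDegree ≤ b) :
    (circuitLinear R c k d).totalDegree ≤ b + 1 := by
  refine (totalDegree_finsetSum _ _).trans (Finset.sup_le fun j hj => ?_)
  have hX := totalDegree_X_le (R := R) (circuitVar c k j)
  have hU := h j (Finset.mem_range.1 hj)
  exact (totalDegree_mul _ _).trans (by lia)

theorem totalDegree_circuitUniversal_succ_le (k d : ℕ) :
    (circuitUniversal R k (d + 1)).totalDegree ≤ (2 * d + 1) * (k + 1) := by
  induction k using Nat.strong_induction_on generalizing d with
  | _ k ih =>
    have hlinear (c d : ℕ) : (circuitLinear R c k (d + 1)).totalDegree ≤ (2 * d + 1) * k + 1 :=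
      totalDegree_circuitLinear_le fun j hj => (ih j hj d).trans (Nat.mul_le_mul_left _ hj)
    rw [circuitUniversal_eq]
    refine (totalDegree_add _ _).trans (max_le ((totalDegree_add _ _).trans (max_le ?_ ?_)) ?_)
    · split_ifs
      · exact (totalDegree_X_le _).trans (Nat.mul_pos (by lia) (by lia))
      · rw [totalDegree_zero]
        exact Nat.zero_le _
    · exact (hlinear 1 d).trans (by lia)
    · refine (totalDegree_finsetSum _ _).trans (Finset.sup_le fun e he => ?_)
      obtain ⟨a, rfl⟩ := Nat.exists_eq_add_of_le' (Finset.mem_Ico.1 he).1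
      obtain ⟨b, rfl⟩ := Nat.exists_eq_add_of_lt (Nat.lt_of_succ_lt_succ (Finset.mem_Ico.1 he).2)
      rw [show a + b + 1 + 1 - (a + 1) = b + 1 by lia]
      have ha := hlinear 2 a
      have hb := hlinear 3 b
      exact (totalDegree_mul _ _).trans (by nlinarith)

theorem totalDegree_circuitFamily_le (n : ℕ) :
    (circuitFamily R n).totalDegree ≤ (2 * n + 1) * (n + 1) := by
  refine (totalDegree_add _ _).trans (max_le ((totalDegree_X_le _).trans ?_) ?_)
  · exact Nat.mul_pos (by lia) (by lia)
  refine (totalDegree_finsetSum _ _).trans (Finset.sup_le fun d hd => ?_)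
  obtain ⟨h, hdn⟩ := Finset.mem_Icc.1 hd
  obtain ⟨d, rfl⟩ := Nat.exists_eq_add_of_le' h
  exact (totalDegree_circuitUniversal_succ_le n d).trans (Nat.mul_le_mul_right _ (by lia))

theorem straightLine_circuitLinear {T : Set (MvPolynomial ℕ R)} {k D : ℕ}
    (hT : ∀ j < k, ∀ d ≤ D, circuitUniversal R j d ∈ T) :
    StraightLine False T (4 * k + 4 * (D + 1) * (2 * k + 1))
      (T ∪ {p | ∃ c < 4, ∃ d ≤ D, circuitLinear R c k d = p}) := by
  have coefficients := StraightLine.insert_image (sk := False) (S := T)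
    (Finset.range 4 ×ˢ Finset.range k) (fun x => X (circuitVar x.1 k x.2))
    fun x _ => StraightLine.refl.insert (.varOrConst (.X _))
  set V : Set (MvPolynomial ℕ R) := T ∪ (fun x : ℕ × ℕ => X (circuitVar x.1 k x.2)) ''
    ((Finset.range 4 ×ˢ Finset.range k : Finset (ℕ × ℕ)) : Set (ℕ × ℕ))
  have linear := StraightLine.insert_image (sk := False) (S := V)
    (Finset.range 4 ×ˢ Finset.range (D + 1)) (fun x => circuitLinear R x.1 k x.2) fun x hx => by
      obtain ⟨hc, hd⟩ := Finset.mem_product.1 hx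
      refine StraightLine.insert_sum _ _ fun j hj => .mul False.elim (.inr ⟨(x.1, j), ?_, rfl⟩)
        (.inl (hT j (Finset.mem_range.1 hj) x.2 (Nat.lt_succ_iff.1 (Finset.mem_range.1 hd))))
      exact Finset.mem_coe.2 (Finset.mem_product.2 ⟨hc, hj⟩)
  refine ((coefficients.trans linear).mono ?_).subset (Set.union_subset ?_ ?_)
  · simp [Finset.card_product]
  · exact Set.subset_union_left.trans Set.subset_union_left
  · rintro _ ⟨c, hc, d, hd, rfl⟩
    exact .inr ⟨(c, d), by simp [hc, Nat.lt_succ_iff.2 hd], rfl⟩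

theorem straightLine_circuitUniversal {T : Set (MvPolynomial ℕ R)} {k d D : ℕ} (hdD : d ≤ D)
    (hT : ∀ c < 4, ∀ d ≤ D, circuitLinear R c k d ∈ T) :
    StraightLine False T (2 * D + 4) (insert (circuitUniversal R k d) T) := by
  have products := StraightLine.insert_sum (sk := False) (S := T) (Finset.Ico 1 d)
    (fun e => circuitLinear R 2 k e * circuitLinear R 3 k (d - e)) fun e he =>
      .mul False.elim (hT 2 (by lia) e ((Finset.mem_Ico.1 he).2.le.trans hdD))
        (hT 3 (by lia) (d - e) ((Nat.sub_le d e).trans hdD))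
  have leaf := products.insert (p := if d = 1 then X (circuitVar 0 k 0) else 0)
    (.varOrConst (by split_ifs; exacts [.X _, .zero]))
  have affine := leaf.insert (.add (.inl rfl) (.inr (.inr (hT 1 (by lia) d hdD))))
  have sum := affine.insert (.add (.inl rfl) (.inr (.inr (.inl rfl))))
  rw [← circuitUniversal_eq] at sum
  refine (sum.mono ?_).subset (Set.insert_subset_insert fun p hp => .inr (.inr (.inr hp)))
  rw [Nat.card_Ico]
  lia

theorem straightLine_circuitUniversal_le (k D : ℕ) :
    StraightLine False ∅ (k * ((D + 1) * (12 * k + 2 * D + 8)))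
      {p | ∃ j < k, ∃ d ≤ D, circuitUniversal R j d = p} := by
  induction k with
  | zero => simpa using StraightLine.refl
  | succ k ih =>
    have linear := straightLine_circuitLinear
      (T := {p | ∃ j < k, ∃ d ≤ D, circuitUniversal R j d = p})
      fun j hj d hd => ⟨j, hj, d, hd, rfl⟩
    have components := StraightLine.insert_image (Finset.range (D + 1)) (circuitUniversal R k)
      fun d hd => straightLine_circuitUniversal (T := {p | ∃ j < k, ∃ d ≤ D,
          circuitUniversal R j d = p} ∪ {p | ∃ c < 4, ∃ d ≤ D, circuitLinear R c k d = p})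
        (Nat.lt_succ_iff.1 (Finset.mem_range.1 hd)) fun c hc d hd => .inr ⟨c, hc, d, hd, rfl⟩
    refine (((ih.trans linear).trans components).mono ?_).subset ?_
    · rw [Finset.card_range]
      nlinarith
    · rintro _ ⟨j, hj, d, hd, rfl⟩
      rcases (Nat.lt_succ_iff.1 hj).eq_or_lt with rfl | hj
      · exact .inr ⟨d, by simp [Nat.lt_succ_iff.2 hd], rfl⟩
      · exact .inl (.inl ⟨j, hj, d, hd, rfl⟩)

theorem straightLine_circuitFamily (n : ℕ) :
    StraightLine False ∅ ((n + 1) * ((n + 1) * (12 * (n + 1) + 2 * n + 8)) + (2 * n + 4))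
      {circuitFamily R n} := by
  have components := (straightLine_circuitUniversal_le (R := R) (n + 1) n).insert
    (.varOrConst .zero)
  have sum := StraightLine.insert_sum (sk := False)
    (S := insert 0 {p | ∃ j < n + 1, ∃ d ≤ n, circuitUniversal R j d = p})
    (Finset.Icc 1 n) (circuitUniversal R n) fun d hd =>
      add_zero (circuitUniversal R n d) ▸
        .add (.inr ⟨n, n.lt_succ_self, d, (Finset.mem_Icc.1 hd).2, rfl⟩) (.inl rfl)
  have leaf := (components.trans sum).insert (.varOrConst (.X (circuitVar 4 0 0)))
  have hfamily := leaf.insert (.add (.inl rfl) (.inr (.inl rfl)))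
  rw [Nat.card_Icc, Nat.add_sub_cancel] at hfamily
  exact (hfamily.mono (by lia)).subset (Set.singleton_subset_iff.2 (.inl rfl))

end CircuitUniversal

section CircuitProjection

variable {R : Type*} [CommSemiring R] {v : ℕ → MvPolynomial ℕ R}

/-- `y c j` for `c = 0, 1, 2, 3` are the values of the coefficient variables `circuitVar c k j`
which make the universal circuit follow a given instruction. -/
theorem IsStep.exists_coefficients {sk : Prop} {k : ℕ} {p : MvPolynomial ℕ R}
    (h : IsStep sk (v '' Set.Iio k) p) :
    ∃ y : ℕ → ℕ → MvPolynomial ℕ R, (∀ c j, IsVarOrConst (y c j)) ∧ ∀ d, 1 ≤ d →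
      homogeneousComponent d p = (if d = 1 then y 0 0 else 0) +
        ∑ j ∈ Finset.range k, y 1 j * homogeneousComponent d (v j) +
        ∑ e ∈ Finset.Ico 1 d, (∑ j ∈ Finset.range k, y 2 j * homogeneousComponent e (v j)) *
          ∑ j ∈ Finset.range k, y 3 j * homogeneousComponent (d - e) (v j) := by
  cases h with
  | varOrConst hp =>
    rcases hp with ⟨i, rfl⟩ | ⟨a, rfl⟩
    · refine ⟨fun c _ => if c = 0 then X i else 0, fun c _ => ?_, fun d _ => ?_⟩
      · dsimp only
        split_ifs
        exacts [.X i, .zero]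
      · simp [homogeneousComponent_of_mem (isHomogeneous_X R i)]
    · refine ⟨0, fun _ _ => .zero, fun d hd => ?_⟩
      rw [homogeneousComponent_eq_zero d _ (by rwa [totalDegree_C])]
      simp
  | add hp hq =>
    obtain ⟨a, ha, rfl⟩ := hp
    obtain ⟨b, hb, rfl⟩ := hq
    rw [Set.mem_Iio] at ha hb
    refine ⟨fun c j => C (if c = 1 then (if j = a then 1 else 0) + (if j = b then 1 else 0) else 0),
      fun _ _ => .C _, fun d _ => ?_⟩
    simp [add_mul, Finset.sum_add_distrib, apply_ite C, ite_mul, ha, hb]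
  | mul hsk hp hq =>
    obtain ⟨a, ha, rfl⟩ := hp
    obtain ⟨b, hb, rfl⟩ := hq
    rw [Set.mem_Iio] at ha hb
    refine ⟨fun c j => C (match c with
      | 0 => 0
      | 1 => (if j = b then coeff 0 (v a) else 0) + (if j = a then coeff 0 (v b) else 0)
      | 2 => if j = a then 1 else 0
      | _ => if j = b then 1 else 0), fun _ _ => .C _, fun d hd => ?_⟩
    simp [homogeneousComponent_mul_of_pos _ _ hd, add_mul, Finset.sum_add_distrib, apply_ite C,
      ite_mul, ha, hb]

theorem bind₁_circuitUniversal {φ : ℕ → MvPolynomial ℕ R} {n : ℕ}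
    (h : ∀ k < n, ∀ d, 1 ≤ d → homogeneousComponent d (v k) =
      (if d = 1 then φ (circuitVar 0 k 0) else 0) +
        ∑ j ∈ Finset.range k, φ (circuitVar 1 k j) * homogeneousComponent d (v j) +
        ∑ e ∈ Finset.Ico 1 d,
          (∑ j ∈ Finset.range k, φ (circuitVar 2 k j) * homogeneousComponent e (v j)) *
          ∑ j ∈ Finset.range k, φ (circuitVar 3 k j) * homogeneousComponent (d - e) (v j))
    {k d : ℕ} (hk : k < n) (hd : 1 ≤ d) :
    bind₁ φ (circuitUniversal R k d) = homogeneousComponent d (v k) := by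
  induction k using Nat.strong_induction_on generalizing d with
  | _ k ih =>
    have hlinear (c : ℕ) {d : ℕ} (hd : 1 ≤ d) : bind₁ φ (circuitLinear R c k d) =
        ∑ j ∈ Finset.range k, φ (circuitVar c k j) * homogeneousComponent d (v j) := by
      rw [circuitLinear, map_sum]
      refine Finset.sum_congr rfl fun j hj => ?_
      have hj := Finset.mem_range.1 hj
      rw [map_mul, bind₁_X_right, ih j hj (hj.trans hk) hd]
    rw [circuitUniversal_eq, h k hk d hd, map_add, map_add, map_sum, hlinear 1 hd,
      apply_ite (bind₁ φ), bind₁_X_right, map_zero]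
    refine congrArg _ (Finset.sum_congr rfl fun e he => ?_)
    obtain ⟨he, hed⟩ := Finset.mem_Ico.1 he
    rw [map_mul, hlinear 2 he, hlinear 3 (Nat.sub_pos_of_lt hed)]

end CircuitProjection

section CircuitFamily

variable {K : Type u} [Field K]

theorem IsStepSequence.isProjection_circuitFamily {sk : Prop} {v : ℕ → MvPolynomial ℕ K} {n : ℕ}
    (hv : IsStepSequence sk (n + 1) v) (hdeg : (v n).totalDegree ≤ n) :
    IsProjection (v n) (circuitFamily K n) := by
  choose! y hy hvy using fun k hk => (hv k hk).exists_coefficients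
  let φ : ℕ → MvPolynomial ℕ K := fun i =>
    if i.unpair.1 < 4 ∧ i.unpair.2.unpair.1 < n + 1 then
      y i.unpair.2.unpair.1 i.unpair.1 i.unpair.2.unpair.2
    else C (coeff 0 (v n))
  have hφ {c k : ℕ} (hc : c < 4) (hk : k < n + 1) (j : ℕ) : φ (circuitVar c k j) = y k c j := by
    simp only [φ, circuitVar, Nat.unpair_pair]
    rw [if_pos ⟨hc, hk⟩]
  have hU (d : ℕ) (hd : 1 ≤ d) :
      bind₁ φ (circuitUniversal K n d) = homogeneousComponent d (v n) := by
    refine bind₁_circuitUniversal (fun k hk d hd => ?_) n.lt_succ_self hd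
    simpa only [hφ, hk, Nat.reduceLT] using hvy k hk d hd
  refine isProjection_iff.2 ⟨φ, fun i => ?_, ?_⟩
  · simp only [φ]
    split_ifs with h
    exacts [hy _ h.2 _ _, .C _]
  · have hconst : φ (circuitVar 4 0 0) = C (coeff 0 (v n)) := by simp [φ, circuitVar]
    rw [circuitFamily, map_add, map_sum, bind₁_X_right, hconst]
    conv_lhs => rw [eq_C_add_sum_homogeneousComponent hdeg]
    exact congrArg _ (Finset.sum_congr rfl fun d hd => (hU d (Finset.mem_Icc.1 hd).1).symm)

theorem circuitFamily_mem_VP : circuitFamily K ∈ VP K := by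
  rw [VP_eq_classOf]
  have hs : PolyBounded fun n =>
      (n + 1) * ((n + 1) * (12 * (n + 1) + 2 * n + 8)) + (2 * n + 4) :=
    ⟨(.X + 1) * ((.X + 1) * (12 * (.X + 1) + 2 * .X + 8)) + (2 * .X + 4), fun n => by simp⟩
  have hdeg : PolyBounded fun n => (2 * n + 1) * (n + 1) :=
    ⟨(2 * .X + 1) * (.X + 1), fun n => by simp⟩
  exact ⟨⟨hs.mono fun n => (straightLine_circuitFamily n).vars_card_le,
    hdeg.mono totalDegree_circuitFamily_le⟩, _, hs, straightLine_circuitFamily⟩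

theorem pProjection_circuitFamily {g : Family K} (hg : g ∈ VP K) :
    PProjection g (circuitFamily K) := by
  rw [VP_eq_classOf] at hg
  obtain ⟨⟨-, hdeg⟩, s, hs, h⟩ := hg
  refine ⟨_, (hs.add hdeg).add (.const 1), fun n => ?_⟩
  have hline := (h n).mono (Nat.le_add_right _ (g n).totalDegree)
  obtain ⟨v, hv, hvn⟩ := hline.exists_isStepSequence_eq
  have hprojection := hv.isProjection_circuitFamily (by rw [hvn]; lia)
  rwa [hvn] at hprojection

end CircuitFamily

theorem isDenseIn_complete_VP (K : Type u) [Field K] (r : ReductionKind) :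
    IsDenseIn (Complete VP r) VP K := by
  have hmem := circuitFamily_mem_VP (K := K)
  have huniv (G) := pProjection_circuitFamily (K := RatFunc K) (g := G)
  rw [VP_eq_classOf] at *
  refine isDenseIn_complete (isMeasure_straightLineLE False) hmem (fun G hG => ?_) r
  simpa only [lift, map_circuitFamily] using huniv G hG

theorem isDenseIn_diff_complete_VP (K : Type u) [Field K] :
    IsDenseIn (Diff VP (Complete VP .p)) VP K := by
  rw [VP_eq_classOf]
  exact isDenseIn_diff_complete (isMeasure_straightLineLE False)

/-! ### Hamiltonian cycle sums -/

section CyclicPermutation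

variable {α β : Type*}

theorem decomposeOption_symm_none [DecidableEq α] (u : Option α) (τ : Equiv.Perm α) :
    Equiv.Perm.decomposeOption.symm (u, τ) none = u := by
  simp [Equiv.Perm.decomposeOption]

theorem decomposeOption_symm_some [DecidableEq α] (a : α) (τ : Equiv.Perm α) (i : α) :
    Equiv.Perm.decomposeOption.symm (some a, τ) (some i) =
      if τ i = a then none else some (τ i) := by
  simp only [Equiv.Perm.decomposeOption_symm_apply, Equiv.Perm.coe_mul, Function.comp,
    Equiv.optionCongr_apply, Option.map_some]
  split_ifs with h
  · rw [h, Equiv.swap_apply_right]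
  · exact Equiv.swap_apply_of_ne_of_ne (Option.some_ne_none _) (by simpa using h)

variable [Finite α]

theorem isCycleOn_univ_iff_forall_invariant (σ : Equiv.Perm α) :
    σ.IsCycleOn Set.univ ↔ ∀ P : α → Prop, (∀ x, P x → P (σ x)) → ∀ x y, P x → P y := by
  refine ⟨fun h P hP x y hx => ?_, fun h => ⟨by simpa using σ.bijective, fun x _ y _ => ?_⟩⟩
  · obtain ⟨k, rfl⟩ := (h.2 (Set.mem_univ x) (Set.mem_univ y)).exists_nat_pow_eq
    induction k with
    | zero => exact hx
    | succ k ih => simpa only [pow_succ', Equiv.Perm.mul_apply] using hP _ ih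
  · exact h (σ.SameCycle x) (fun z hz => Equiv.Perm.sameCycle_apply_right.2 hz) x y (.refl σ x)

theorem isCycleOn_univ_permCongr (e : α ≃ β) (σ : Equiv.Perm α) :
    (e.permCongr σ).IsCycleOn Set.univ ↔ σ.IsCycleOn Set.univ := by
  have := Finite.of_equiv α e
  simp only [isCycleOn_univ_iff_forall_invariant]
  refine ⟨fun h P hP x y hx => ?_, fun h P hP x y hx => ?_⟩
  · simpa using h (fun z => P (e.symm z)) (fun z hz => by simpa using hP _ hz) (e x) (e y)
      (by simpa using hx)
  · simpa using h (fun z => P (e z)) (fun z hz => by simpa using hP _ hz) (e.symm x) (e.symm y)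
      (by simpa using hx)

variable [DecidableEq α]

theorem not_isCycleOn_univ_decomposeOption_none [Nonempty α] (τ : Equiv.Perm α) :
    ¬ (Equiv.Perm.decomposeOption.symm (none, τ)).IsCycleOn Set.univ := by
  rw [isCycleOn_univ_iff_forall_invariant]
  intro h
  obtain ⟨a⟩ := ‹Nonempty α›
  exact Option.some_ne_none a (h (· = none)
    (fun o ho => by rw [ho, decomposeOption_symm_none]) none (some a) rfl)

variable {a : α} {τ : Equiv.Perm α}

theorem isCycleOn_univ_of_decomposeOption_some
    (h : (Equiv.Perm.decomposeOption.symm (some a, τ)).IsCycleOn Set.univ) :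
    τ.IsCycleOn Set.univ := by
  rw [isCycleOn_univ_iff_forall_invariant] at h ⊢
  intro P hP x y hx
  refine h (fun o => o.elim (P a) P) (fun o ho => ?_) (some x) (some y) hx
  rcases o with _ | i
  · rwa [decomposeOption_symm_none]
  · rw [decomposeOption_symm_some]
    have hi : P (τ i) := hP i ho
    split_ifs with hia
    · rwa [hia] at hi
    · exact hi

theorem isCycleOn_univ_decomposeOption_some_of (h : τ.IsCycleOn Set.univ) :
    (Equiv.Perm.decomposeOption.symm (some a, τ)).IsCycleOn Set.univ := by
  rw [isCycleOn_univ_iff_forall_invariant] at h ⊢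
  intro P hP
  have hnone (h : P none) : P (some a) := decomposeOption_symm_none (some a) τ ▸ hP none h
  have hsome (i : α) (hi : P (some i)) : P (some (τ i)) := by
    have hi := hP _ hi
    rw [decomposeOption_symm_some] at hi
    split_ifs at hi with hia
    · exact hia ▸ hnone hi
    · exact hi
  have hall := h (fun i => P (some i)) hsome
  have hto (o : Option α) (ho : P o) : P (some a) := by
    cases o with
    | none => exact hnone ho
    | some i => exact hall i a ho
  rintro o (_ | j) ho
  · simpa [decomposeOption_symm_some] using hP _ (hall a (τ.symm a) (hto o ho))
  · exact hall a j (hto o ho)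

theorem isCycleOn_univ_decomposeOption_some :
    (Equiv.Perm.decomposeOption.symm (some a, τ)).IsCycleOn Set.univ ↔ τ.IsCycleOn Set.univ :=
  ⟨isCycleOn_univ_of_decomposeOption_some, isCycleOn_univ_decomposeOption_some_of⟩

end CyclicPermutation

section HamiltonSum

variable {α β R S : Type*} [Fintype α] [DecidableEq α] [Fintype β] [DecidableEq β]
  [CommSemiring R] [CommSemiring S]

open Classical in
/-- The sum of the weights of all Hamiltonian cycles of the complete digraph on `α` with
edge weights `M`. -/
noncomputable def hamiltonSum (M : α → α → R) : R :=
  ∑ π : Equiv.Perm α, if π.IsCycleOn Set.univ then ∏ i, M i (π i) else 0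

theorem HC_eq_hamiltonSum (K : Type u) [Field K] (n : ℕ) :
    HC K n = hamiltonSum fun i j : Fin n => X (Nat.pair i j) := by
  rw [HC, Finset.sum_filter, hamiltonSum]

theorem map_hamiltonSum {F : Type*} [FunLike F R S] [RingHomClass F R S]
    (φ : F) (M : α → α → R) : φ (hamiltonSum M) = hamiltonSum fun i j => φ (M i j) := by
  simp only [hamiltonSum, map_sum, apply_ite φ, map_prod, map_zero]

theorem hamiltonSum_equiv (e : α ≃ β) (M : β → β → R) :
    hamiltonSum (fun i j => M (e i) (e j)) = hamiltonSum M := by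
  rw [hamiltonSum, hamiltonSum, ← Equiv.sum_comp e.permCongr]
  refine Finset.sum_congr rfl fun σ _ => ?_
  rw [← Equiv.prod_comp e]
  simp only [Equiv.permCongr_apply, Equiv.symm_apply_apply]
  classical exact if_congr (isCycleOn_univ_permCongr e σ).symm rfl rfl

theorem hamiltonSum_of_isEmpty [IsEmpty α] (M : α → α → R) : hamiltonSum M = 1 := by
  simp [hamiltonSum, Equiv.Perm.isCycleOn_of_subsingleton]

theorem hamiltonSum_unique [Unique α] (M : α → α → R) : hamiltonSum M = M default default := by
  simp [hamiltonSum, Equiv.Perm.isCycleOn_of_subsingleton]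

/-- Expansion along the predecessor of the additional vertex `none`. -/
theorem hamiltonSum_option [Nonempty α] (M : Option α → Option α → R) :
    hamiltonSum M = ∑ w, M (some w) none *
      hamiltonSum fun i j => if i = w then M none (some j) else M (some i) (some j) := by
  classical
  rw [hamiltonSum, ← Equiv.sum_comp Equiv.Perm.decomposeOption.symm, Fintype.sum_prod_type,
    Fintype.sum_option, Finset.sum_eq_zero
      fun τ _ => if_neg (not_isCycleOn_univ_decomposeOption_none τ), zero_add, Finset.sum_comm]
  simp only [hamiltonSum, Finset.mul_sum]
  rw [Finset.sum_comm (s := Finset.univ (α := α))]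
  refine Finset.sum_congr rfl fun τ _ => ?_
  rw [← Equiv.sum_comp τ]
  refine Finset.sum_congr rfl fun w _ => ?_
  simp only [isCycleOn_univ_decomposeOption_some]
  split_ifs with hτ
  swap
  · rw [mul_zero]
  rw [Fintype.prod_option, decomposeOption_symm_none]
  simp only [decomposeOption_symm_some, τ.injective.eq_iff]
  rw [← Finset.mul_prod_erase _ _ (Finset.mem_univ w),
    ← Finset.mul_prod_erase _ _ (Finset.mem_univ w), if_pos rfl, if_pos rfl, mul_left_comm]
  refine congrArg _ (congrArg _ (Finset.prod_congr rfl fun i hi => ?_))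
  rw [if_neg (Finset.ne_of_mem_erase hi), if_neg (Finset.ne_of_mem_erase hi)]

theorem hamiltonSum_row_add_mul (M : α → α → R) (i : α) (A B : α → R) (c : R) :
    hamiltonSum (fun x y => if x = i then A y + c * B y else M x y) =
      hamiltonSum (fun x y => if x = i then A y else M x y) +
        c * hamiltonSum (fun x y => if x = i then B y else M x y) := by
  have hprod (σ : Equiv.Perm α) (A : α → R) :
      ∏ x, (if x = i then A (σ x) else M x (σ x)) =
        A (σ i) * ∏ x ∈ Finset.univ.erase i, M x (σ x) := by
    rw [← Finset.mul_prod_erase _ _ (Finset.mem_univ i), if_pos rfl]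
    exact congrArg _ (Finset.prod_congr rfl fun x hx => if_neg (Finset.ne_of_mem_erase hx))
  simp only [hamiltonSum, Finset.mul_sum, ← Finset.sum_add_distrib]
  refine Finset.sum_congr rfl fun σ _ => ?_
  rw [hprod σ A, hprod σ B, hprod σ fun y => A y + c * B y]
  split_ifs <;> ring

/-- A new vertex after `w`, which takes over the outgoing edges of `w`. -/
def subdivide (M : α → α → R) (w : α) : Option α → Option α → R
  | none, none => 0
  | none, some y => M w y
  | some x, none => if x = w then 1 else 0
  | some x, some y => if x = w then 0 else M x y

theorem hamiltonSum_subdivide (M : α → α → R) (w : α) :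
    hamiltonSum (subdivide M w) = hamiltonSum M := by
  have : Nonempty α := ⟨w⟩
  rw [hamiltonSum_option, Finset.sum_eq_single w]
  · simp only [subdivide, if_true, one_mul]
    congr 1
    funext x y
    split_ifs with h <;> simp [h]
  · exact fun x _ hx => by simp [subdivide, hx]
  · exact fun h => absurd (Finset.mem_univ w) h

/-- Two new vertices after `i`, which may be traversed in two orders: one of them leads to the
old successors of `i`, the other one is a detour from `i` to `j` of weight `p * q * r`. -/
def addDetour (M : α → α → R) (i j : α) (p q r : R) : Option (Option α) → Option (Option α) → R
  | none, none => 0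
  | none, some none => q
  | none, some (some y) => M i y
  | some none, none => 1
  | some none, some none => 0
  | some none, some (some y) => if y = j then r else 0
  | some (some x), none => if x = i then p else 0
  | some (some x), some none => if x = i then 1 else 0
  | some (some x), some (some y) => if x = i then 0 else M x y

theorem hamiltonSum_addDetour (M : α → α → R) (i j : α) (p q r : R) :
    hamiltonSum (addDetour M i j p q r) =
      hamiltonSum fun x y => M x y + if x = i ∧ y = j then p * q * r else 0 := by
  have : Nonempty α := ⟨i⟩
  have hrow : (fun x y => M x y + if x = i ∧ y = j then p * q * r else 0) = fun x y =>
      if x = i then M i y + p * q * (if y = j then r else 0) else M x y := by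
    funext x y
    split_ifs <;> simp_all
  rw [hrow, hamiltonSum_row_add_mul, hamiltonSum_option, Fintype.sum_option,
    Finset.sum_eq_single i, hamiltonSum_option, Finset.sum_eq_single i, hamiltonSum_option,
    Finset.sum_eq_single i]
  · simp only [addDetour, reduceCtorEq, if_true, if_false, Option.some.injEq, one_mul, mul_assoc]
    congr! 4
    · split_ifs <;> rfl
    · funext x y
      by_cases hx : x = i <;> simp [hx]
  all_goals simp +contextual [addDetour]

end HamiltonSum

section IsHamiltonSum

variable {R S : Type*} [CommRing R] [CommRing S] {p : MvPolynomial ℕ R} {m n : ℕ}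

/-- `p` is a Hamiltonian cycle sum on `m` vertices whose weights are variables and constants. -/
def IsHamiltonSum (p : MvPolynomial ℕ R) (m : ℕ) : Prop :=
  ∃ M : Fin m → Fin m → MvPolynomial ℕ R, (∀ i j, IsVarOrConst (M i j)) ∧ p = hamiltonSum M

theorem isHamiltonSum_card {α : Type*} [Fintype α] [DecidableEq α]
    {M : α → α → MvPolynomial ℕ R} (hM : ∀ i j, IsVarOrConst (M i j)) :
    IsHamiltonSum (hamiltonSum M) (Fintype.card α) :=
  ⟨fun i j => M ((Fintype.equivFin α).symm i) ((Fintype.equivFin α).symm j),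
    fun _ _ => hM _ _, (hamiltonSum_equiv _ M).symm⟩

namespace IsHamiltonSum

theorem succ (h : IsHamiltonSum p m) : IsHamiltonSum p (m + 1) := by
  obtain ⟨M, hM, rfl⟩ := h
  rcases Nat.eq_zero_or_pos m with rfl | hm
  · refine ⟨fun _ _ => 1, fun _ _ => .one, ?_⟩
    rw [hamiltonSum_of_isEmpty]
    exact (hamiltonSum_unique (α := Fin 1) fun _ _ => 1).symm
  · have hsub := isHamiltonSum_card (M := subdivide M ⟨0, hm⟩) fun x y => by
      rcases x with _ | x <;> rcases y with _ | y <;> simp only [subdivide] <;> try split_ifs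
      exacts [.zero, hM _ _, .one, .zero, .zero, hM _ _]
    rwa [hamiltonSum_subdivide, Fintype.card_option, Fintype.card_fin] at hsub

theorem mono (h : IsHamiltonSum p m) (hmn : m ≤ n) : IsHamiltonSum p n := by
  induction hmn with
  | refl => exact h
  | step _ ih => exact ih.succ

theorem map (h : IsHamiltonSum p m) (φ : R →+* S) : IsHamiltonSum (map φ p) m := by
  obtain ⟨M, hM, rfl⟩ := h
  exact ⟨fun i j => MvPolynomial.map φ (M i j), fun i j => (hM i j).map φ, map_hamiltonSum _ M⟩

theorem vars_card_le (h : IsHamiltonSum p m) : p.vars.card ≤ m * m := by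
  classical
  obtain ⟨M, hM, rfl⟩ := h
  have hsub : (hamiltonSum M).vars ⊆
      (Finset.univ : Finset (Fin m × Fin m)).biUnion fun x => (M x.1 x.2).vars := by
    refine (vars_sum_subset _ _).trans (Finset.biUnion_subset.2 fun σ _ => ?_)
    split_ifs
    · refine (vars_prod _).trans (Finset.biUnion_subset.2 fun i _ => ?_)
      exact Finset.subset_biUnion_of_mem (fun x : Fin m × Fin m => (M x.1 x.2).vars)
        (Finset.mem_univ (i, σ i))
    · simp
  refine (Finset.card_le_card hsub).trans (Finset.card_biUnion_le.trans ?_)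
  refine (Finset.sum_le_card_nsmul _ _ 1 fun x _ => (hM _ _).vars_card_le).trans ?_
  simp

theorem totalDegree_le (h : IsHamiltonSum p m) : p.totalDegree ≤ m := by
  obtain ⟨M, hM, rfl⟩ := h
  refine (totalDegree_finsetSum _ _).trans (Finset.sup_le fun σ _ => ?_)
  split_ifs
  · refine (totalDegree_finsetProd _ _).trans ?_
    refine (Finset.sum_le_card_nsmul _ _ 1 fun i _ => (hM _ _).totalDegree_le).trans ?_
    simp
  · simp

end IsHamiltonSum

/-- `p` is the sum of a variable or constant and `n` products of three variables or constants. As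
the weight of an edge, `p` can be realized by `n` detours. -/
def IsDetourSum : ℕ → MvPolynomial ℕ R → Prop
  | 0, p => IsVarOrConst p
  | n + 1, p => ∃ w a b c, IsDetourSum n w ∧ IsVarOrConst a ∧ IsVarOrConst b ∧ IsVarOrConst c ∧
      p = w + a * b * c

/-- The numbers of detours in the weights `addDetour M i j p q r`, given those in `M`. -/
def addDetourCount {α : Type*} [DecidableEq α] (k : α → α → ℕ) (i : α) :
    Option (Option α) → Option (Option α) → ℕ
  | none, some (some y) => k i y
  | some (some x), some (some y) => if x = i then 0 else k x y
  | _, _ => 0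

section Detours

variable {α : Type*} [DecidableEq α] {M : α → α → MvPolynomial ℕ R} {k : α → α → ℕ}

theorem isDetourSum_addDetour (h : ∀ x y, IsDetourSum (k x y) (M x y)) (i j : α)
    {p q r : MvPolynomial ℕ R} (hp : IsVarOrConst p) (hq : IsVarOrConst q) (hr : IsVarOrConst r)
    (x y : Option (Option α)) :
    IsDetourSum (addDetourCount k i x y) (addDetour M i j p q r x y) := by
  have hzero : IsDetourSum 0 (0 : MvPolynomial ℕ R) := IsVarOrConst.zero
  have hone : IsDetourSum 0 (1 : MvPolynomial ℕ R) := IsVarOrConst.one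
  rcases x with _ | _ | x <;> rcases y with _ | _ | y <;>
    simp only [addDetour, addDetourCount] <;> try split_ifs
  exacts [hzero, hq, h _ _, hone, hzero, hr, hzero, hp, hzero, hone, hzero, hzero, h _ _]

theorem sum_addDetourCount [Fintype α] (k : α → α → ℕ) (i : α) :
    ∑ x, ∑ y, addDetourCount k i x y = ∑ x, ∑ y, k x y := by
  have hrow (x : α) : ∑ y, (if x = i then 0 else k x y) = if x = i then 0 else ∑ y, k x y := by
    split_ifs <;> simp
  simp only [Fintype.sum_option, addDetourCount, hrow, zero_add, Finset.sum_const_zero]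
  rw [← Finset.add_sum_erase _ (fun x => ∑ y, k x y) (Finset.mem_univ i), Finset.sum_ite,
    Finset.sum_const_zero, zero_add, Finset.filter_ne']

theorem isHamiltonSum_of_isDetourSum [Fintype α] (h : ∀ x y, IsDetourSum (k x y) (M x y)) :
    IsHamiltonSum (hamiltonSum M) (Fintype.card α + 2 * ∑ x, ∑ y, k x y) := by
  induction hN : ∑ x, ∑ y, k x y generalizing α with
  | zero =>
    simp only [Finset.sum_eq_zero_iff, Finset.mem_univ, true_imp_iff] at hN
    exact isHamiltonSum_card fun x y => (hN x y ▸ h x y :)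
  | succ N ih =>
    obtain ⟨i, -, hi⟩ := Finset.exists_ne_zero_of_sum_ne_zero (hN.trans_ne N.succ_ne_zero)
    obtain ⟨j, -, hij⟩ := Finset.exists_ne_zero_of_sum_ne_zero hi
    obtain ⟨l, hl⟩ := Nat.exists_eq_succ_of_ne_zero hij
    obtain ⟨w, a, b, c, hw, ha, hb, hc, hM⟩ := hl ▸ h i j
    let M₀ x y := if x = i ∧ y = j then w else M x y
    let k₀ x y := if x = i ∧ y = j then l else k x y
    have h₀ (x y : α) : IsDetourSum (k₀ x y) (M₀ x y) := by
      simp only [k₀, M₀]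
      split_ifs
      exacts [hw, h x y]
    have hdetour : hamiltonSum (addDetour M₀ i j a b c) = hamiltonSum M := by
      rw [hamiltonSum_addDetour]
      congr 1
      funext x y
      simp only [M₀]
      split_ifs with hxy
      · rw [hxy.1, hxy.2, hM]
      · rw [add_zero]
    have hcount : ∑ x, ∑ y, k x y = (∑ x, ∑ y, k₀ x y) + 1 := by
      have hk (x y : α) : k x y = k₀ x y + if x = i then (if y = j then 1 else 0) else 0 := by
        simp only [k₀]
        split_ifs <;> simp_all
      simp only [hk, Finset.sum_add_distrib]
      simp
    have hsum := ih (isDetourSum_addDetour h₀ i j ha hb hc)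
      ((sum_addDetourCount k₀ i).trans (Nat.succ_injective (hcount.symm.trans hN)))
    rw [hdetour, Fintype.card_option, Fintype.card_option] at hsum
    convert hsum using 1
    ring

end Detours

theorem isHamiltonSum_of_isDetourSum_const {M : Fin m → Fin m → MvPolynomial ℕ R}
    (h : ∀ i j, IsDetourSum n (M i j)) :
    IsHamiltonSum (hamiltonSum M) (m + 2 * (m * (m * n))) := by
  simpa using isHamiltonSum_of_isDetourSum (k := fun _ _ => n) h

theorem IsHamiltonSum.deform (h : IsHamiltonSum p m) (e : R) :
    IsHamiltonSum (deform e p) (m + 2 * (m * (m * 1))) := by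
  obtain ⟨M, hM, rfl⟩ := h
  rw [map_hamiltonSum]
  refine isHamiltonSum_of_isDetourSum_const fun i j => ?_
  rcases hM i j with ⟨x, hx⟩ | ⟨c, hc⟩
  · exact ⟨X x, C e, X x, X x, .X x, .C e, .X x, .X x, by rw [hx, deform_X, mul_assoc]⟩
  · exact ⟨C c, 0, 0, 0, .C c, .zero, .zero, .zero, by rw [hc, deform_C]; simp⟩

end IsHamiltonSum

section VNP

variable {K : Type u} [Field K] {m n : ℕ}

theorem isProjection_HC_iff {p : MvPolynomial ℕ K} :
    IsProjection p (HC K m) ↔ IsHamiltonSum p m := by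
  rw [isProjection_iff, HC_eq_hamiltonSum]
  simp only [map_hamiltonSum, bind₁_X_right]
  constructor
  · rintro ⟨α, hα, rfl⟩
    exact ⟨fun i j => α (Nat.pair i j), fun i j => hα _, rfl⟩
  · rintro ⟨M, hM, rfl⟩
    refine ⟨fun k => if h : k.unpair.1 < m ∧ k.unpair.2 < m then M ⟨_, h.1⟩ ⟨_, h.2⟩ else 0,
      fun k => ?_, by simp⟩
    dsimp only
    split_ifs
    exacts [hM _ _, .zero]

theorem isProjection_HC_of_le (h : m ≤ n) : IsProjection (HC K m) (HC K n) :=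
  isProjection_HC_iff.2 (IsHamiltonSum.mono ⟨_, fun _ _ => .X _, HC_eq_hamiltonSum K m⟩ h)

theorem mem_VNP_iff {f : Family K} :
    f ∈ VNP K ↔ ∃ t, PolyBounded t ∧ ∀ n, IsHamiltonSum (f n) (t n) := by
  constructor
  · rintro ⟨-, t, ht, h⟩
    exact ⟨t, ht, fun n => isProjection_HC_iff.1 (h n)⟩
  · rintro ⟨t, ht, h⟩
    exact ⟨⟨(ht.mul ht).mono fun n => (h n).vars_card_le, ht.mono fun n => (h n).totalDegree_le⟩,
      t, ht, fun n => isProjection_HC_iff.2 (h n)⟩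

theorem isPerturbation_hamiltonSum {N : Fin m → Fin m → MvPolynomial ℕ (RatFunc K)}
    {M : Fin m → Fin m → MvPolynomial ℕ K} (h : ∀ i j, IsPerturbation (N i j) (M i j)) :
    IsPerturbation (hamiltonSum N) (hamiltonSum M) := by
  simp only [isPerturbation_iff] at *
  choose G hN hM using h
  exact ⟨hamiltonSum G, by simp only [map_hamiltonSum, hN], by simp only [map_hamiltonSum, hM]⟩

/-- The perturbation `p + ε (y w + v)` of the weight `p` of the `k`-th edge, where `y`, `w`, `v` are
variables with indices from `B` on, of which `w` and `v` belong to this edge only. -/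
noncomputable def freeWeight (B : ℕ) (p : MvPolynomial ℕ K) (k : ℕ) : MvPolynomial ℕ (RatFunc K) :=
  perturb p (X (B + Nat.pair 0 0) * X (B + Nat.pair 1 k) + X (B + Nat.pair 2 k))

theorem freeWeight_eq (B : ℕ) (p : MvPolynomial ℕ K) (k : ℕ) : freeWeight B p k =
    lift p + C RatFunc.X * X (B + Nat.pair 0 0) * X (B + Nat.pair 1 k) +
      C RatFunc.X * X (B + Nat.pair 2 k) * 1 := by
  simp only [freeWeight, perturb, map_add, map_mul, map_X]
  ring

theorem isDetourSum_freeWeight {p : MvPolynomial ℕ K} (hp : IsVarOrConst p)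
    (B k : ℕ) : IsDetourSum 2 (freeWeight B p k) :=
  ⟨_, C RatFunc.X, X (B + Nat.pair 2 k), 1, ⟨lift p, C RatFunc.X, X (B + Nat.pair 0 0),
    X (B + Nat.pair 1 k), hp.map _, .C _, .X _, .X _, rfl⟩, .C _, .X _, .one, freeWeight_eq B p k⟩

/-- Substituting `0` for the variables of `p` leaves a constant `c`; the free weight becomes `x` by
`y ↦ ε⁻¹`, `w ↦ x` and `v ↦ -ε⁻¹ c`. -/
theorem bind₁_freeWeight {α : ℕ → MvPolynomial ℕ (RatFunc K)} {B k : ℕ} {p : MvPolynomial ℕ K}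
    (hp : ∀ i ∈ p.vars, α i = 0) (hy : α (B + Nat.pair 0 0) = C RatFunc.X⁻¹)
    (hv : α (B + Nat.pair 2 k) = C (-(RatFunc.X⁻¹ * constantCoeff (lift p)))) :
    bind₁ α (freeWeight B p k) = α (B + Nat.pair 1 k) := by
  have hconst : bind₁ α (lift p) = C (constantCoeff (lift p)) :=
    bind₁_eq_C_constantCoeff fun i hi => hp i (vars_map _ _ hi)
  have hinv : (C RatFunc.X * C RatFunc.X⁻¹ : MvPolynomial ℕ (RatFunc K)) = 1 := by
    rw [← C_mul, mul_inv_cancel₀ RatFunc.X_ne_zero, C_1]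
  rw [freeWeight_eq]
  simp only [map_add, map_mul, map_one, bind₁_X_right, bind₁_C_right, hconst, hy, hv, C_neg]
  linear_combination (α (B + Nat.pair 1 k) - C (constantCoeff (lift p))) * hinv

theorem isProjection_HC_hamiltonSum_freeWeight {B : ℕ} {M : Fin m → Fin m → MvPolynomial ℕ K}
    (hB : ∀ i j, ∀ x ∈ (M i j).vars, x < B) :
    IsProjection (HC (RatFunc K) m)
      (hamiltonSum fun i j => freeWeight B (M i j) (Nat.pair i j)) := by
  let c (k : ℕ) : RatFunc K := if h : k.unpair.1 < m ∧ k.unpair.2 < m then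
    constantCoeff (lift (M ⟨_, h.1⟩ ⟨_, h.2⟩)) else 0
  have hc (i j : Fin m) : c (Nat.pair i j) = constantCoeff (lift (M i j)) := by simp [c]
  let β : ℕ × ℕ → MvPolynomial ℕ (RatFunc K)
    | (0, _) => C RatFunc.X⁻¹
    | (1, k) => X k
    | (_, k) => C (-(RatFunc.X⁻¹ * c k))
  let α (x : ℕ) : MvPolynomial ℕ (RatFunc K) := if x < B then 0 else β (x - B).unpair
  have hα (x y : ℕ) : α (B + Nat.pair x y) = β (x, y) := by simp [α]
  refine isProjection_iff.2 ⟨α, fun x => ?_, ?_⟩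
  · simp only [α, β]
    split_ifs
    · exact .zero
    · split
      exacts [.C _, .X _, .C _]
  · rw [HC_eq_hamiltonSum, map_hamiltonSum]
    congr 1
    funext i j
    have hv : α (B + Nat.pair 2 (Nat.pair i j)) =
        C (-(RatFunc.X⁻¹ * constantCoeff (lift (M i j)))) := by
      rw [hα, ← hc]
      rfl
    rw [bind₁_freeWeight (α := α) (fun x hx => if_pos (hB i j x hx)) (hα 0 0) hv, hα]
    rfl

theorem IsHamiltonSum.exists_isPerturbation {f : MvPolynomial ℕ K} (hf : IsHamiltonSum f m) :
    ∃ F, IsPerturbation F f ∧ IsHamiltonSum F (m + 2 * (m * (m * 2))) ∧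
      IsProjection (HC (RatFunc K) m) F := by
  classical
  obtain ⟨M, hM, rfl⟩ := hf
  obtain ⟨B, hB⟩ := Finset.exists_nat_subset_range
    ((Finset.univ : Finset (Fin m × Fin m)).biUnion fun x => (M x.1 x.2).vars)
  refine ⟨hamiltonSum fun i j => freeWeight B (M i j) (Nat.pair i j),
    isPerturbation_hamiltonSum fun i j => ⟨_, rfl⟩,
    isHamiltonSum_of_isDetourSum_const fun i j => isDetourSum_freeWeight (hM i j) _ _,
    isProjection_HC_hamiltonSum_freeWeight fun i j x hx => ?_⟩
  exact Finset.mem_range.1 (hB (Finset.mem_biUnion.2 ⟨(i, j), Finset.mem_univ _, hx⟩))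

theorem isDenseIn_VNPC (K : Type u) [Field K] (r : ReductionKind) :
    IsDenseIn (VNPC r) VNP K := by
  refine isDenseIn_of_isPerturbation (fun f hf => hf.1) (fun F hF => hF.1.1) (fun f hf => hf.1)
    fun f hf => ?_
  obtain ⟨t, ht, h⟩ := mem_VNP_iff.1 hf
  choose F hFf hF hHC using fun n => ((h n).mono (Nat.le_add_right _ n)).exists_isPerturbation
  have hm : PolyBounded fun n => t n + n := ht.add .id
  have hVNP : F ∈ VNP (RatFunc K) :=
    mem_VNP_iff.2 ⟨_, hm.add ((PolyBounded.const 2).mul (hm.mul (hm.mul (.const 2)))), hF⟩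
  have hred : PProjection (HC (RatFunc K)) F :=
    ⟨fun n => n, .id, fun n => (isProjection_HC_of_le (Nat.le_add_left n (t n))).trans (hHC n)⟩
  exact ⟨F, ⟨hVNP, hred.reduces hVNP.1 r⟩, hFf⟩

theorem isDenseIn_diff_VNPC (K : Type u) [Field K] : IsDenseIn (Diff VNP (VNPC .p)) VNP K := by
  refine isDenseIn_diff (fun _ _ _ hf => hf.1) (fun f hf => ?_) ?_
  · obtain ⟨t, ht, h⟩ := mem_VNP_iff.1 hf
    exact mem_VNP_iff.2 ⟨_, ht.add ((PolyBounded.const 2).mul (ht.mul (ht.mul (.const 1)))),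
      fun n => ((h n).map _).deform _⟩
  · rintro F ⟨-, t, -, ht⟩
    have h := ht 1
    rw [HC_eq_hamiltonSum, hamiltonSum_unique (α := Fin 1)] at h
    exact ⟨t 1, h⟩

end VNP

end AlgComplexity

theorem theorem1 (K : Type u) [Field K] :
    (∀ r : AlgComplexity.ReductionKind,
      AlgComplexity.IsDenseIn (AlgComplexity.VNPC r) AlgComplexity.VNP K ∧
      AlgComplexity.IsDenseIn (AlgComplexity.Complete AlgComplexity.VF r) AlgComplexity.VF K ∧
      AlgComplexity.IsDenseIn (AlgComplexity.Complete AlgComplexity.VBP r) AlgComplexity.VBP K ∧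
      AlgComplexity.IsDenseIn (AlgComplexity.Complete AlgComplexity.VP r) AlgComplexity.VP K) ∧
    AlgComplexity.IsDenseIn
      (AlgComplexity.Diff AlgComplexity.VNP (AlgComplexity.VNPC .p)) AlgComplexity.VNP K ∧
    AlgComplexity.IsDenseIn
      (AlgComplexity.Diff AlgComplexity.VF (AlgComplexity.Complete AlgComplexity.VF .p))
      AlgComplexity.VF K ∧
    AlgComplexity.IsDenseIn
      (AlgComplexity.Diff AlgComplexity.VBP (AlgComplexity.Complete AlgComplexity.VBP .p))
      AlgComplexity.VBP K ∧
    AlgComplexity.IsDenseIn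
      (AlgComplexity.Diff AlgComplexity.VP (AlgComplexity.Complete AlgComplexity.VP .p))
      AlgComplexity.VP K := by
  open AlgComplexity in
  exact ⟨fun r => ⟨isDenseIn_VNPC K r, isDenseIn_complete_VF K r, isDenseIn_complete_VBP K r,
      isDenseIn_complete_VP K r⟩,
    isDenseIn_diff_VNPC K, isDenseIn_diff_complete_VF K, isDenseIn_diff_complete_VBP K,
    isDenseIn_diff_complete_VP K⟩
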